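/- A composition of $n$ is a finite sequence of positive integers with sum $n$ (its parts). A meander with $n$ nodes is a pair $\frac{\lambda}{\mu}$ of compositions of $n$. Its seaweed algebra $\mathfrak p_n\frac{\lambda}{\mu}$ is the Lie subalgebra of $\mathfrak{gl}_n(\mathbb C)$ of all matrices whose nonzero entries strictly above the diagonal lie in the diagonal blocks of sizes $\lambda_1,\lambda_2,\dots$, and whose nonzero entries strictly below the diagonal lie in the diagonal blocks of sizes $\mu_1,\mu_2,\dots$. The index of $\frac{\lambda}{\mu}$ is the index of this Lie algebra, where $\operatorname{ind}(\mathfrak g)=\min_{f\in\mathfrak g^*}\dim\{x\in\mathfrak g : f([x,y])=0\text{ for all }y\in\mathfrak g\}$. For a set $J$ of positive integers let $a^J_{n,k}$ be the number of meanders with $n$ nodes and index $k$ such that all parts of both compositions lie in $J$, and let $A_J(x,y)=\sum_{n,k\ge 0}a^J_{n,k}x^ny^k$ (the empty meander gives $a^J_{0,0}=1$). Let $i^J_{n,k}$ be the number of those meanders counted by $a^J_{n,k}$ that are indecomposable, i.e. have $n\ge 1$ and are not of the form $\frac{\lambda_1|\lambda_2}{\mu_1|\mu_2}$ (concatenation)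 for meanders $\frac{\lambda_1}{\mu_1}$, $\frac{\lambda_2}{\mu_2}$ with fewer than $n$ nodes each; put $i^J_{n,k}=0$ for $k<0$. **Theorem.** As formal power series, $$A_{\{1,4\}}(x,y)=\frac{1-x^2-x^4-x^3y+x^6}{(1-xy-x^4y^4)(1-x^2-x^4-x^3y+x^6)-2x^4y(x+y-x^3)}.$$ With $i_{n,k}=i^{\{1,4\}}_{n,k}$, for all $n>10$ and all integers $k$, $$i_{n,k}=i_{n-2,k}+i_{n-3,k-1}+i_{n-4,k}-i_{n-6,k}.$$ Moreover, for every integer $c\ge 1$, $A_{\{c,4c\}}(x,y)=A_{\{1,4\}}(x^c,y^c)$. -/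

import Mathlib

attribute [local instance 100] LieRing.ofAssociativeRing

/-- The stabilizer `𝔤_f = {x | f ⁅x, y⁆ = 0 for all y}` of a linear form `f` on a Lie algebra
under the coadjoint action. -/
def coadjointStabilizer (K : Type*) {L : Type*} [Field K] [LieRing L] [LieAlgebra K L]
    (f : Module.Dual K L) : Submodule K L where
  carrier := {x | ∀ y : L, f ⁅x, y⁆ = 0}
  add_mem' := by
    intro a b ha hb y
    change ∀ y : L, f ⁅a, y⁆ = 0 at ha
    change ∀ y : L, f ⁅b, y⁆ = 0 at hb
    rw [add_lie, map_add, ha, hb, add_zero]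
  zero_mem' := by
    intro y
    rw [zero_lie, map_zero]
  smul_mem' := by
    intro c x hx y
    change ∀ y : L, f ⁅x, y⁆ = 0 at hx
    rw [smul_lie, map_smul, hx, smul_zero]

/-- The index of a (finite-dimensional) Lie algebra: the minimum over all linear forms `f` of the
dimension of the stabilizer of `f`. -/
noncomputable def lieIndex (K : Type*) (L : Type*) [Field K] [LieRing L] [LieAlgebra K L] : ℕ :=
  ⨅ f : Module.Dual K L, Module.finrank K (coadjointStabilizer K f)

/-- A meander with `n` nodes: a pair (upper composition, lower composition) of compositions of
`n`. -/
abbrev Meander (n : ℕ) : Type := Composition n × Composition n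

namespace Meander

/-- The position `(i, j)` may hold a nonzero entry in the seaweed algebra of `m`: above the
diagonal `i` and `j` must lie in the same block of the upper composition, below the diagonal in
the same block of the lower composition; the diagonal is unrestricted. -/
def Allowed {n : ℕ} (m : Meander n) (i j : Fin n) : Prop :=
  (i < j → m.1.index i = m.1.index j) ∧ (j < i → m.2.index i = m.2.index j)

theorem index_mono {n : ℕ} (c : Composition n) {i j : Fin n} (h : i ≤ j) :
    c.index i ≤ c.index j := by
  by_contra hlt
  have h1 : (c.index j).succ.val ≤ (c.index i).val := by
    simpa using Nat.succ_le_of_lt (not_le.mp hlt)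
  have h2 := c.lt_sizeUpTo_index_succ j
  have h3 := c.sizeUpTo_index_le i
  have h4 := c.monotone_sizeUpTo h1
  have h5 : (i : ℕ) ≤ j := h
  omega

theorem index_eq_of_between {n : ℕ} (c : Composition n) {i j k : Fin n} (hij : i ≤ j)
    (hjk : j ≤ k) (h : c.index i = c.index k) : c.index i = c.index j :=
  le_antisymm (index_mono c hij) (h ▸ index_mono c hjk)

theorem Allowed.trans {n : ℕ} {m : Meander n} {i j k : Fin n} (h : m.Allowed i j)
    (h' : m.Allowed j k) : m.Allowed i k := by
  constructor
  · intro hik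
    rcases lt_trichotomy i j with hij | hij | hij
    · rcases lt_trichotomy j k with hjk | hjk | hjk
      · exact (h.1 hij).trans (h'.1 hjk)
      · exact hjk ▸ h.1 hij
      · exact index_eq_of_between m.1 hik.le hjk.le (h.1 hij)
    · exact hij ▸ h'.1 (hij ▸ hik)
    · have e := h'.1 (hij.trans hik)
      exact (index_eq_of_between m.1 hij.le hik.le e).symm.trans e
  · intro hki
    rcases lt_trichotomy i j with hij | hij | hij
    · have e := h'.2 (hki.trans hij)
      exact (index_eq_of_between m.2 hki.le hij.le e.symm).symm
    · exact hij ▸ h'.2 (hij ▸ hki)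
    · rcases lt_trichotomy j k with hjk | hjk | hjk
      · have e := h.2 hij
        exact e.trans (index_eq_of_between m.2 hjk.le hki.le e.symm)
      · exact hjk ▸ h.2 hij
      · exact (h.2 hij).trans (h'.2 hjk)

theorem allowed_mul {n : ℕ} {K : Type*} [Field K] {m : Meander n}
    {A B : Matrix (Fin n) (Fin n) K} (hA : ∀ i j, A i j ≠ 0 → m.Allowed i j)
    (hB : ∀ i j, B i j ≠ 0 → m.Allowed i j) (i j : Fin n) (h : (A * B) i j ≠ 0) :
    m.Allowed i j := by
  rw [Matrix.mul_apply] at h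
  obtain ⟨k, -, hk⟩ := Finset.exists_ne_zero_of_sum_ne_zero h
  exact (hA i k (left_ne_zero_of_mul hk)).trans (hB k j (right_ne_zero_of_mul hk))

/-- The seaweed algebra of a meander, as a Lie subalgebra of `𝔤𝔩_n(K)`. -/
def seaweed (K : Type*) [Field K] {n : ℕ} (m : Meander n) :
    LieSubalgebra K (Matrix (Fin n) (Fin n) K) where
  carrier := {A | ∀ i j, A i j ≠ 0 → m.Allowed i j}
  add_mem' := by
    intro A B hA hB i j h
    by_cases hz : A i j = 0
    · exact hB i j (fun hz' => h (by simp [hz, hz']))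
    · exact hA i j hz
  zero_mem' := by
    intro i j h
    exact absurd rfl h
  smul_mem' := by
    intro c A hA i j h
    exact hA i j (fun hz => h (by simp [hz]))
  lie_mem' := by
    intro A B hA hB i j h
    rw [Ring.lie_def] at h
    by_cases hz : (A * B) i j = 0
    · exact allowed_mul hB hA i j (fun hz' => h (by simp [hz, hz']))
    · exact allowed_mul hA hB i j hz

/-- The index of a meander: the index of its seaweed algebra over `ℂ`. -/
noncomputable def ind {n : ℕ} (m : Meander n) : ℕ :=
  lieIndex ℂ (m.seaweed ℂ)

/-- All parts of both compositions lie in `J`. -/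
def PartsIn {n : ℕ} (m : Meander n) (J : Set ℕ) : Prop :=
  (∀ p ∈ m.1.blocks, p ∈ J) ∧ (∀ p ∈ m.2.blocks, p ∈ J)

/-- `m` is the direct sum of `m₁` and `m₂`: upper and lower compositions are concatenated. -/
def IsDirectSum {n a b : ℕ} (m : Meander n) (m₁ : Meander a) (m₂ : Meander b) : Prop :=
  m.1.blocks = m₁.1.blocks ++ m₂.1.blocks ∧ m.2.blocks = m₁.2.blocks ++ m₂.2.blocks

/-- A nonempty meander that is not the direct sum of two strictly smaller meanders. -/
def IsIndecomposable {n : ℕ} (m : Meander n) : Prop :=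
  0 < n ∧ ¬ ∃ a b : ℕ, a < n ∧ b < n ∧
    ∃ (m₁ : Meander a) (m₂ : Meander b), m.IsDirectSum m₁ m₂

/-- `a_{n,k}^J`: the number of meanders with `n` nodes, parts in `J` and index `k`. -/
noncomputable def count (J : Set ℕ) (n k : ℕ) : ℕ :=
  {m : Meander n | m.PartsIn J ∧ m.ind = k}.ncard

/-- `i_{n,k}^J`: the number of indecomposable meanders with `n` nodes, parts in `J` and index `k`;
`k` is an integer, so that the number is `0` for negative `k`. -/
noncomputable def indecomposableCount (J : Set ℕ) (n : ℕ) (k : ℤ) : ℕ :=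
  {m : Meander n | m.IsIndecomposable ∧ m.PartsIn J ∧ (m.ind : ℤ) = k}.ncard

/-- `A_J(x,y) = ∑ a_{n,k}^J x^n y^k`, a formal power series in `x = X 0` and `y = X 1`. -/
noncomputable def genFun (J : Set ℕ) : MvPowerSeries (Fin 2) ℚ :=
  fun d => (count J (d 0) (d 1) : ℚ)

end Meander

/-! The index is computed by reductions that shrink a meander and change its index by a known
amount. Every linear form on a seaweed algebra is `x ↦ trace (F * x)`, so the index is the least
dimension of a space of matrices that are supported on a relation and commute with `F` at the
transposed positions (`Meander.ind_eq_relIndex`). If both compositions start with a, a copy of gl_a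
splits off and contributes a (`listIndex_cons_self`). If they start with a and 2a+d, Panyushev's
reduction deletes the block a and replaces 2a+d by d|a without changing the index
(`listIndex_cons_of_two_mul_le`, from `relIndex_glueRel`): a generic form is conjugate to one with
an off-diagonal block that is essentially a partial permutation matrix, and the remaining block then
determines the stabilizer.

For parts 1 and 4 this leaves three rules: cancel equal first parts; 1|1|L over 4|M has the index of
L over 1|1|M; 1|4|L over 4|M has the index of 1|L over M. The reductions are homogeneous in the
block sizes, so multiplying all parts by c multiplies the index by c (`scaledIndex_eq_mul`), which
gives the last claim.

For the series, let S(P/Q) enumerate the completions of initial segments P, Q to a meander. Adding a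
part on the shorter side and applying the rules gives a closed linear system, which expresses S(1/4)
through S(∅/∅) (`completionSeries_one_four`). The rules keep the difference of the partial sums, so
the same system holds when the partial sums may not meet before the end; the switch `b` treats both
cases at once. Over all meanders S(∅/∅) = A and A = 1 + (xy+x⁴y⁴)A + 2S(1/4). Over indecomposable
ones S(∅/∅) = 1, so their series xy + x⁴y⁴ + 2S(1/4) is rational with denominator 1-x²-x⁴-x³y+x⁶ and
a numerator of degree 10 in x; hence the recurrence for n > 10. -/

section

open Matrix Module Filter Topology

/-! ### Stabilizers of trace forms: conjugation and semicontinuity -/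

/-- The matrices supported on a relation. -/
def relSupported {ι : Type*} (R : ι → ι → Prop) : Submodule ℂ (Matrix ι ι ℂ) where
  carrier := {A | ∀ i j, A i j ≠ 0 → R i j}
  add_mem' := by
    intro A B hA hB i j h
    by_cases hz : A i j = 0
    · exact hB i j (fun hz' => h (by simp [hz, hz']))
    · exact hA i j hz
  zero_mem' := by
    intro i j h
    exact absurd rfl h
  smul_mem' := by
    intro c A hA i j h
    exact hA i j (fun hz => h (by simp [hz]))

/-- The matrices `x` supported on `R` such that `F * x - x * F` vanishes on the transpose of `R`:
for transitive `R`, the stabilizer of the form `x ↦ trace (F * x)`. -/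
def relStabilizer {ι : Type*} [Fintype ι] (R : ι → ι → Prop) (F : Matrix ι ι ℂ) :
    Submodule ℂ (Matrix ι ι ℂ) where
  carrier := {x | x ∈ relSupported R ∧ ∀ i j, R i j → (F * x) j i = (x * F) j i}
  add_mem' := by
    rintro x y ⟨hx, hx'⟩ ⟨hy, hy'⟩
    refine ⟨add_mem hx hy, fun i j h => ?_⟩
    rw [mul_add, add_mul, Matrix.add_apply, Matrix.add_apply, hx' i j h, hy' i j h]
  zero_mem' := ⟨zero_mem _, fun i j _ => by simp⟩
  smul_mem' := by
    rintro c x ⟨hx, hx'⟩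
    refine ⟨Submodule.smul_mem _ _ hx, fun i j h => ?_⟩
    rw [Matrix.mul_smul, Matrix.smul_mul, Matrix.smul_apply, Matrix.smul_apply, hx' i j h]

theorem mem_relStabilizer {ι : Type*} [Fintype ι] {R : ι → ι → Prop} {F x : Matrix ι ι ℂ} :
    x ∈ relStabilizer R F ↔
      x ∈ relSupported R ∧ ∀ i j, R i j → (F * x) j i = (x * F) j i := Iff.rfl

/-- The least dimension of a stabilizer. -/
noncomputable def relIndex {ι : Type*} [Fintype ι] (R : ι → ι → Prop) : ℕ :=
  ⨅ F : Matrix ι ι ℂ, finrank ℂ (relStabilizer R F)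

theorem relIndex_le {ι : Type*} [Fintype ι] (R : ι → ι → Prop) (F : Matrix ι ι ℂ) :
    relIndex R ≤ finrank ℂ (relStabilizer R F) :=
  ciInf_le (OrderBot.bddBelow _) F

theorem le_relIndex {ι : Type*} [Fintype ι] {R : ι → ι → Prop} {k : ℕ}
    (h : ∀ F : Matrix ι ι ℂ, k ≤ finrank ℂ (relStabilizer R F)) : k ≤ relIndex R :=
  le_ciInf h

theorem exists_relIndex_eq {ι : Type*} [Fintype ι] (R : ι → ι → Prop) :
    ∃ F : Matrix ι ι ℂ, finrank ℂ (relStabilizer R F) = relIndex R :=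
  Nat.sInf_mem (Set.range_nonempty _)

theorem finrank_le_of_injOn {V W : Type*} [AddCommGroup V] [Module ℂ V] [AddCommGroup W]
    [Module ℂ W] [FiniteDimensional ℂ W] (f : V →ₗ[ℂ] W) (S : Submodule ℂ V) (T : Submodule ℂ W)
    (hmem : ∀ x ∈ S, f x ∈ T) (hinj : ∀ x ∈ S, f x = 0 → x = 0) :
    finrank ℂ S ≤ finrank ℂ T := by
  refine LinearMap.finrank_le_finrank_of_injective (f := f.restrict hmem) ?_
  rw [injective_iff_map_eq_zero]
  rintro ⟨x, hx⟩ h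
  have h' := congrArg Subtype.val h
  exact Subtype.ext (hinj x hx h')

theorem mem_relStabilizer_iff_trace {ι : Type*} [Fintype ι] [DecidableEq ι] {R : ι → ι → Prop}
    {F x : Matrix ι ι ℂ} :
    x ∈ relStabilizer R F ↔
      x ∈ relSupported R ∧ ∀ y ∈ relSupported R, trace (F * (x * y - y * x)) = 0 := by
  have key : ∀ y : Matrix ι ι ℂ, trace (F * (x * y - y * x)) = trace ((F * x - x * F) * y) := by
    intro y
    rw [mul_sub, sub_mul, trace_sub, trace_sub, ← mul_assoc, ← mul_assoc, trace_mul_comm (F * y) x,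
      mul_assoc x F y]
  rw [mem_relStabilizer]
  refine and_congr_right fun _ => ⟨fun h y hy => ?_, fun h i j hij => ?_⟩
  · rw [key, trace]
    refine Finset.sum_eq_zero fun j _ => ?_
    rw [diag_apply, mul_apply]
    refine Finset.sum_eq_zero fun i _ => ?_
    by_cases hz : y i j = 0
    · rw [hz, mul_zero]
    · rw [Matrix.sub_apply, h i j (hy i j hz), sub_self, zero_mul]
  · have := h (single i j 1) (fun a b hab => by
      by_cases h1 : i = a ∧ j = b
      · rw [← h1.1, ← h1.2]; exact hij
      · exact absurd (single_apply_of_ne _ _ _ _ _ h1) hab)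
    rw [key, trace_mul_single] at this
    simpa [sub_eq_zero] using this

/-- Coadjoint action of the invertible elements: `x ↦ g * x * h` carries the stabilizer of the
conjugated form into that of `F`. Transitivity of `R` keeps the products inside the algebra. -/
theorem finrank_relStabilizer_le_conj {ι : Type*} [Fintype ι] [DecidableEq ι]
    {R : ι → ι → Prop} (htrans : ∀ i j k, R i j → R j k → R i k) (F : Matrix ι ι ℂ)
    {g h : Matrix ι ι ℂ} (hg : g ∈ relSupported R) (hh : h ∈ relSupported R) (hgh : g * h = 1) :
    finrank ℂ (relStabilizer R (h * F * g)) ≤ finrank ℂ (relStabilizer R F) := by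
  have hhg : h * g = 1 := mul_eq_one_comm.mp hgh
  have hmul : ∀ {A B : Matrix ι ι ℂ}, A ∈ relSupported R → B ∈ relSupported R →
      A * B ∈ relSupported R := by
    intro A B hA hB i j hne
    rw [mul_apply] at hne
    obtain ⟨k, -, hk⟩ := Finset.exists_ne_zero_of_sum_ne_zero hne
    exact htrans i k j (hA i k (left_ne_zero_of_mul hk)) (hB k j (right_ne_zero_of_mul hk))
  refine finrank_le_of_injOn (LinearMap.mulLeft ℂ g ∘ₗ LinearMap.mulRight ℂ h) _ _ ?_ ?_
  · intro x hx
    rw [mem_relStabilizer_iff_trace] at hx ⊢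
    simp only [LinearMap.comp_apply, LinearMap.mulLeft_apply, LinearMap.mulRight_apply]
    refine ⟨hmul hg (hmul hx.1 hh), fun y hy => ?_⟩
    have := hx.2 (h * y * g) (hmul (hmul hh hy) hg)
    rw [← this]
    have e1 : h * F * g * (x * (h * y * g) - h * y * g * x) * (h * g)
        = h * (F * (g * (x * h) * y - y * (g * (x * h))) * g) := by
      have e2 : h * F * g * (h * y * g * x) * (h * g) = h * F * y * g * x * (h * g) := by
        rw [show h * F * g * (h * y * g * x) * (h * g) = h * F * (g * h) * y * g * x * (h * g) by
          simp only [mul_assoc], hgh, mul_one]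
      have e3 : h * F * g * (x * (h * y * g)) * (h * g) = h * F * g * x * h * y * g := by
        rw [hhg, mul_one]
        simp only [mul_assoc]
      rw [mul_sub, sub_mul, e2, e3]
      simp only [mul_assoc, mul_sub, sub_mul]
    rw [← mul_one (h * F * g * (x * (h * y * g) - h * y * g * x)), ← hhg, e1, trace_mul_comm h,
      mul_assoc _ g h, hgh, mul_one, mul_assoc g]
  · intro x _ hx
    simp only [LinearMap.comp_apply, LinearMap.mulLeft_apply, LinearMap.mulRight_apply] at hx
    calc x = (h * g) * x * (h * g) := by rw [hhg, one_mul, mul_one]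
      _ = h * (g * (x * h)) * g := by simp only [mul_assoc]
      _ = 0 := by rw [hx, mul_zero, zero_mul]

/-- Rank is lower semicontinuous: vectors with images forming a basis of the range of `A` keep
independent images under a small perturbation. -/
theorem eventually_finrank_ker_le {V κ : Type*} [AddCommGroup V] [Module ℂ V]
    [FiniteDimensional ℂ V] [Fintype κ] (A B : V →ₗ[ℂ] (κ → ℂ)) :
    ∀ᶠ t in 𝓝 (0 : ℂ), finrank ℂ (LinearMap.ker (A + t • B)) ≤ finrank ℂ (LinearMap.ker A) := by
  let b := finBasis ℂ (LinearMap.range A)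
  choose v hv using fun i => (b i).2
  have hli : LinearIndependent ℂ fun i => A (v i) := by
    have := b.linearIndependent.map' (LinearMap.range A).subtype (Submodule.ker_subtype _)
    rwa [show (LinearMap.range A).subtype ∘ b = fun i => A (v i) from
      funext fun i => (hv i).symm] at this
  have hcont : Continuous fun t : ℂ => fun i => (A + t • B) (v i) := by
    refine continuous_pi fun i => ?_
    simp only [LinearMap.add_apply, LinearMap.smul_apply]
    fun_prop
  have h0 : ∀ᶠ f in 𝓝 (fun i => (A + (0 : ℂ) • B) (v i)), LinearIndependent ℂ f := by
    refine LinearIndependent.eventually ?_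
    simpa using hli
  filter_upwards [hcont.continuousAt.eventually h0] with t ht
  have h1 := LinearMap.finrank_range_add_finrank_ker A
  have h2 := LinearMap.finrank_range_add_finrank_ker (A + t • B)
  have h3 : finrank ℂ (LinearMap.range A) ≤ finrank ℂ (LinearMap.range (A + t • B)) := by
    have h4 := finrank_span_eq_card ht
    rw [Fintype.card_fin] at h4
    rw [← h4]
    refine Submodule.finrank_mono (Submodule.span_le.2 ?_)
    rintro _ ⟨i, rfl⟩
    exact ⟨v i, rfl⟩
  omega

-- The stabilizer is the kernel of a map depending linearly on the form. Hence a lower bound for the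
-- stabilizer of `F` need only be proved for forms `F + t • G` with small nonzero `t`.
open Classical in
theorem eventually_finrank_relStabilizer_le {ι : Type*} [Fintype ι] (R : ι → ι → Prop)
    (F G : Matrix ι ι ℂ) :
    ∀ᶠ t in 𝓝 (0 : ℂ),
      finrank ℂ (relStabilizer R (F + t • G)) ≤ finrank ℂ (relStabilizer R F) := by
  let ad : Matrix ι ι ℂ → (relSupported R →ₗ[ℂ] (ι × ι → ℂ)) := fun F =>
    { toFun := fun x p => if R p.1 p.2 then (F * x.1 - x.1 * F) p.2 p.1 else 0
      map_add' := by
        intro x y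
        ext p
        simp only [Submodule.coe_add, Pi.add_apply, mul_add, add_mul, Matrix.sub_apply,
          Matrix.add_apply]
        split_ifs
        · ring
        · simp
      map_smul' := by
        intro c x
        ext p
        simp only [Submodule.coe_smul, Pi.smul_apply, Matrix.mul_smul, Matrix.smul_mul, Matrix.sub_apply,
          Matrix.smul_apply, RingHom.id_apply, smul_eq_mul]
        split_ifs
        · ring
        · simp }
  have hker : ∀ F, finrank ℂ (LinearMap.ker (ad F)) = finrank ℂ (relStabilizer R F) := by
    intro F
    rw [← Submodule.finrank_map_subtype_eq]
    suffices h : (LinearMap.ker (ad F)).map (relSupported R).subtype = relStabilizer R F by rw [h]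
    ext x
    simp only [Submodule.mem_map, LinearMap.mem_ker, Submodule.subtype_apply, Subtype.exists,
      exists_and_right, exists_eq_right, mem_relStabilizer]
    refine ⟨fun ⟨h, h'⟩ => ⟨h, fun i j hij => ?_⟩, fun ⟨h, h'⟩ => ⟨h, ?_⟩⟩
    · have := congrFun h' (i, j)
      simpa [ad, hij, sub_eq_zero] using this
    · ext p
      simp only [ad, LinearMap.coe_mk, AddHom.coe_mk, Pi.zero_apply, ite_eq_right_iff]
      intro hp
      rw [Matrix.sub_apply, h' _ _ hp, sub_self]
  have hadd : ∀ t : ℂ, ad (F + t • G) = ad F + t • ad G := by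
    intro t
    ext x p
    simp only [ad, LinearMap.coe_mk, AddHom.coe_mk, LinearMap.add_apply, LinearMap.smul_apply,
      Pi.add_apply, Pi.smul_apply, smul_eq_mul, add_mul, mul_add, Matrix.smul_mul, Matrix.mul_smul,
      Matrix.sub_apply, Matrix.add_apply, Matrix.smul_apply]
    split_ifs
    · ring
    · simp
  filter_upwards [eventually_finrank_ker_le (ad F) (ad G)] with t ht
  rwa [← hadd, hker, hker] at ht

/-! ### Panyushev's reduction for relations -/

/-- The relation on `σ ⊕ κ` that is full on `σ`, given by `R` on `κ`, and that relates exactly the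
elements of `U` to those of `σ`. -/
def glueRel {σ κ : Type*} (R : κ → κ → Prop) (U : κ → Prop) : σ ⊕ κ → σ ⊕ κ → Prop
  | .inl _, .inl _ => True
  | .inl _, .inr _ => False
  | .inr k, .inl _ => U k
  | .inr k, .inr l => R k l

theorem mem_relSupported_glueRel {σ κ : Type*} {R : κ → κ → Prop} {U : κ → Prop}
    {X : Matrix σ σ ℂ} {W : Matrix σ κ ℂ} {Z : Matrix κ σ ℂ} {Y : Matrix κ κ ℂ} :
    fromBlocks X W Z Y ∈ relSupported (glueRel R U) ↔
      W = 0 ∧ (∀ k s, Z k s ≠ 0 → U k) ∧ Y ∈ relSupported R := by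
  constructor
  · intro h
    refine ⟨?_, fun k s => h (.inr k) (.inl s), fun k l => h (.inr k) (.inr l)⟩
    ext s k
    by_contra hne
    exact h (.inl s) (.inr k) hne
  · rintro ⟨rfl, hZ, hY⟩ (s | k) (s' | l) hne
    · trivial
    · exact hne rfl
    · exact hZ k s' hne
    · exact hY k l hne

theorem mem_relStabilizer_glueRel {σ κ : Type*} [Fintype σ] [Fintype κ] {R : κ → κ → Prop}
    {U : κ → Prop} {X A : Matrix σ σ ℂ} {W B : Matrix σ κ ℂ} {Z C : Matrix κ σ ℂ}
    {Y D : Matrix κ κ ℂ} :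
    fromBlocks X W Z Y ∈ relStabilizer (glueRel R U) (fromBlocks A B C D) ↔
      W = 0 ∧ (∀ k s, Z k s ≠ 0 → U k) ∧ Y ∈ relSupported R ∧
      A * X + B * Z = X * A ∧ (∀ k s, U k → (B * Y) s k = (X * B) s k) ∧
      ∀ k l, R k l → (D * Y) l k = (Z * B + Y * D) l k := by
  rw [mem_relStabilizer, mem_relSupported_glueRel, fromBlocks_multiply, fromBlocks_multiply]
  constructor
  · rintro ⟨⟨rfl, hZ, hY⟩, h⟩
    refine ⟨rfl, hZ, hY, ?_, fun k s hk => ?_, fun k l hkl => ?_⟩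
    · ext s s'
      simpa using h (.inl s') (.inl s) trivial
    · simpa using h (.inr k) (.inl s) hk
    · simpa using h (.inr k) (.inr l) hkl
  · rintro ⟨rfl, hZ, hY, h1, h2, h3⟩
    refine ⟨⟨rfl, hZ, hY⟩, ?_⟩
    rintro (s | k) (s' | l) hr
    · simpa using congrFun (congrFun h1 s') s
    · exact hr.elim
    · simpa using h2 k s' hr
    · simpa using h3 k l hr

theorem glueRel_trans {σ κ : Type*} {R : κ → κ → Prop} {U : κ → Prop}
    (htrans : ∀ i j k, R i j → R j k → R i k) (hU : ∀ k l, R k l → U l → U k) :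
    ∀ i j k : σ ⊕ κ, glueRel R U i j → glueRel R U j k → glueRel R U i k := by
  rintro (i | i) (j | j) (k | k) h h' <;> first
    | trivial
    | exact h.elim
    | exact h'.elim
    | exact h
    | exact hU _ _ h h'
    | exact htrans _ _ _ h h'

/-- The partial permutation matrix of `e`. -/
def inclMatrix {σ κ : Type*} [DecidableEq κ] (e : σ → κ) : Matrix σ κ ℂ := fun s k => if k = e s then 1 else 0

theorem mul_inclMatrix_apply {σ κ τ : Type*} [Fintype σ] [DecidableEq κ] {e : σ → κ}
    (he : Function.Injective e) (Z : Matrix τ σ ℂ) (t : τ) (s : σ) : (Z * inclMatrix e) t (e s) = Z t s := by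
  classical
  simp [mul_apply, inclMatrix, he.eq_iff]

theorem mul_inclMatrix_apply_of_notMem {σ κ τ : Type*} [Fintype σ] [DecidableEq κ]
    {e : σ → κ} (Z : Matrix τ σ ℂ) (t : τ) {k : κ}
    (hk : k ∉ Set.range e) : (Z * inclMatrix e) t k = 0 := by
  rw [mul_apply]
  refine Finset.sum_eq_zero fun s _ => ?_
  rw [inclMatrix, if_neg (fun h => hk ⟨s, h.symm⟩), mul_zero]

theorem inclMatrix_mul_apply {σ κ τ : Type*} [Fintype κ] [DecidableEq κ] {e : σ → κ}
    (Y : Matrix κ τ ℂ) (s : σ) (t : τ) :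
    (inclMatrix e * Y) s t = Y (e s) t := by
  simp [mul_apply, inclMatrix]

/-- The lower right block of a block matrix, as a linear map. -/
def toBlocks₂₂Linear (σ κ : Type*) : Matrix (σ ⊕ κ) (σ ⊕ κ) ℂ →ₗ[ℂ] Matrix κ κ ℂ where
  toFun := toBlocks₂₂
  map_add' _ _ := by ext; rfl
  map_smul' _ _ := by ext; rfl

theorem toBlocks₂₂Linear_apply {σ κ : Type*} (x : Matrix (σ ⊕ κ) (σ ⊕ κ) ℂ) :
    toBlocks₂₂Linear σ κ x = x.toBlocks₂₂ := rfl

theorem exists_of_transpose_inclMatrix_mul_ne_zero {σ κ τ : Type*} [Fintype σ] [DecidableEq κ]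
    {e : σ → κ} {M : Matrix σ τ ℂ} {k : κ} {t : τ} (hne : ((inclMatrix e)ᵀ * M) k t ≠ 0) :
    ∃ s, e s = k ∧ M s t ≠ 0 := by
  rw [mul_apply] at hne
  obtain ⟨s, -, hs⟩ := Finset.exists_ne_zero_of_sum_ne_zero hne
  refine ⟨s, ?_, right_ne_zero_of_mul hs⟩
  by_contra hk
  exact left_ne_zero_of_mul hs (if_neg (Ne.symm hk))

section Reduction

variable {σ κ : Type*} [Fintype σ] [DecidableEq σ] [Fintype κ] [DecidableEq κ]
  {R : κ → κ → Prop} {U : κ → Prop} {e : σ → κ}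

/-- Write x as blocks X, Z, Y. The stabilizer equations say that Z vanishes on the rows in the range
of `e`, that X is the restriction of Y to that range, that Y vanishes from the range to the rest of
`U`, and that the rest of Z is an entry of the commutator of `D` and Y. So Y determines x, and the
equations not involving Z are those of the smaller relation. -/
theorem finrank_relStabilizer_le_of_normalized (he : Function.Injective e)
    (hT : ∀ s, U (e s))
    (hfull : ∀ s k, U k → k ∉ Set.range e → R (e s) k)
    (C : Matrix κ σ ℂ) (D : Matrix κ κ ℂ) :
    finrank ℂ (relStabilizer (glueRel R U) (fromBlocks 0 (inclMatrix e) C D)) ≤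
      finrank ℂ (relStabilizer (fun k l => R k l ∧ ¬(k ∈ Set.range e ∧ U l ∧ l ∉ Set.range e))
        D) := by
  refine finrank_le_of_injOn
    (toBlocks₂₂Linear σ κ)
    _ _ ?_ ?_
  · intro x hx
    rw [← fromBlocks_toBlocks x, mem_relStabilizer_glueRel] at hx
    obtain ⟨-, hZ, hY, h1, h2, h3⟩ := hx
    rw [toBlocks₂₂Linear_apply]
    set X := x.toBlocks₁₁
    set Z := x.toBlocks₂₁
    set Y := x.toBlocks₂₂
    have hZT : ∀ s s', Z (e s) s' = 0 := by
      intro s s'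
      have := congrFun (congrFun h1 s) s'
      rwa [zero_mul, mul_zero, zero_add, inclMatrix_mul_apply] at this
    refine ⟨fun k l hne => ⟨hY k l hne, ?_⟩, fun k l hr => ?_⟩
    · rintro ⟨⟨s, rfl⟩, hl, hlT⟩
      have := h2 l s hl
      rw [inclMatrix_mul_apply, mul_inclMatrix_apply_of_notMem _ _ hlT] at this
      exact hne this
    · rw [h3 k l hr.1, Matrix.add_apply, add_eq_right]
      by_cases hk : k ∈ Set.range e
      · obtain ⟨s, rfl⟩ := hk
        rw [mul_inclMatrix_apply he]
        by_contra hne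
        obtain ⟨s', rfl⟩ : l ∈ Set.range e := by
          by_contra hl
          exact hr.2 ⟨⟨s, rfl⟩, hZ l s hne, hl⟩
        exact hne (hZT s' s)
      · exact mul_inclMatrix_apply_of_notMem _ _ hk
  · intro x hx hx0
    rw [← fromBlocks_toBlocks x, mem_relStabilizer_glueRel] at hx
    obtain ⟨hW, hZ, hY, h1, h2, h3⟩ := hx
    rw [toBlocks₂₂Linear_apply] at hx0
    have hX : x.toBlocks₁₁ = 0 := by
      ext s s'
      have := h2 (e s') s (hT s')
      rw [hx0, Matrix.mul_zero, mul_inclMatrix_apply he] at this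
      exact this.symm
    have hZ0 : x.toBlocks₂₁ = 0 := by
      ext l s
      by_contra hne
      by_cases hl : l ∈ Set.range e
      · obtain ⟨s', rfl⟩ := hl
        have := congrFun (congrFun h1 s') s
        rw [zero_mul, mul_zero, zero_add, inclMatrix_mul_apply] at this
        exact hne this
      · have := h3 (e s) l (hfull s l (hZ l s hne) hl)
        rw [hx0, mul_zero, zero_mul, add_zero, mul_inclMatrix_apply he] at this
        exact hne this.symm
    rw [← fromBlocks_toBlocks x, hX, hW, hZ0, hx0, fromBlocks_zero]

/-- The converse reconstruction: X and Z are defined from Y by the formulas that the stabilizer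
equations force. Columns of `B` outside `U` pair with no entry of the algebra, so they may be
arbitrary. -/
theorem finrank_relStabilizer_ge_of_normalized (he : Function.Injective e)
    (hU : ∀ k l, R k l → U l → U k)
    (B : Matrix σ κ ℂ) (C : Matrix κ σ ℂ) (D : Matrix κ κ ℂ)
    (hB : ∀ s k, U k → B s k = inclMatrix e s k) :
      finrank ℂ (relStabilizer (fun k l => R k l ∧ ¬(k ∈ Set.range e ∧ U l ∧ l ∉ Set.range e))
        D) ≤ finrank ℂ (relStabilizer (glueRel R U) (fromBlocks 0 B C D)) := by
  classical
  refine finrank_le_of_injOn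
    { toFun := fun Y : Matrix κ κ ℂ => fromBlocks (Y.submatrix e e) 0
        (of fun l s => if U l ∧ l ∉ Set.range e then (D * Y - Y * D) l (e s) else 0) Y
      map_add' := ?_, map_smul' := ?_ } _ _ ?_ ?_
  · intro Y Y'
    rw [fromBlocks_add, submatrix_add, add_zero]
    congr 1
    ext l s
    simp only [of_apply, Matrix.add_apply, Matrix.sub_apply, mul_add, add_mul]
    split_ifs
    · ring
    · simp
  · intro c Y
    rw [RingHom.id_apply, fromBlocks_smul, submatrix_smul, smul_zero]
    congr 1
    ext l s
    simp only [of_apply, Matrix.smul_apply, Matrix.sub_apply, Matrix.mul_smul, Matrix.smul_mul,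
      smul_eq_mul]
    split_ifs
    · ring
    · simp
  · rintro Y ⟨hY, hYD⟩
    simp only [LinearMap.coe_mk, AddHom.coe_mk]
    rw [mem_relStabilizer_glueRel]
    refine ⟨rfl, fun l s hne => ?_, fun k l hne => (hY k l hne).1, ?_, fun k s hk => ?_,
      fun k l hkl => ?_⟩
    · by_contra hl
      exact hne (if_neg (fun h => hl h.1))
    · rw [zero_mul, mul_zero, zero_add]
      ext s s'
      rw [mul_apply]
      refine Finset.sum_eq_zero fun k _ => ?_
      rw [of_apply]
      split_ifs with h
      · rw [hB s k h.1, inclMatrix, if_neg (fun h' => h.2 ⟨s, h'.symm⟩), zero_mul]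
      · rw [mul_zero]
    · have h1 : (B * Y) s k = (inclMatrix e * Y) s k := by
        rw [mul_apply, mul_apply]
        refine Finset.sum_congr rfl fun k' _ => ?_
        by_cases hz : Y k' k = 0
        · rw [hz, mul_zero, mul_zero]
        · rw [hB s k' (hU k' k (hY k' k hz).1 hk)]
      have h2 : (Y.submatrix e e * B) s k = (Y.submatrix e e * inclMatrix e) s k := by
        rw [mul_apply, mul_apply]
        exact Finset.sum_congr rfl fun s' _ => by rw [hB s' k hk]
      rw [h1, h2, inclMatrix_mul_apply]
      by_cases hkT : k ∈ Set.range e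
      · obtain ⟨s', rfl⟩ := hkT
        rw [mul_inclMatrix_apply he, submatrix_apply]
      · rw [mul_inclMatrix_apply_of_notMem _ _ hkT]
        by_contra hz
        exact (hY _ _ hz).2 ⟨⟨s, rfl⟩, hk, hkT⟩
    · rw [Matrix.add_apply]
      by_cases hl : U l
      · have h1 : ∀ Z : Matrix κ σ ℂ, (Z * B) l k = (Z * inclMatrix e) l k := by
          intro Z
          rw [mul_apply, mul_apply]
          exact Finset.sum_congr rfl fun s' _ => by rw [hB s' k (hU k l hkl hl)]
        rw [h1]
        by_cases hkT : k ∈ Set.range e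
        · obtain ⟨s, rfl⟩ := hkT
          rw [mul_inclMatrix_apply he, of_apply]
          split_ifs with h
          · rw [Matrix.sub_apply, sub_add_cancel]
          · rw [zero_add]
            exact hYD _ _ ⟨hkl, fun h' => h h'.2⟩
        · rw [mul_inclMatrix_apply_of_notMem _ _ hkT, zero_add]
          exact hYD _ _ ⟨hkl, fun h' => hkT h'.1⟩
      · rw [hYD k l ⟨hkl, fun h' => hl h'.2.1⟩, right_eq_add, mul_apply]
        refine Finset.sum_eq_zero fun s _ => ?_
        rw [of_apply, if_neg (fun h => hl h.1), zero_mul]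
  · intro Y _ h
    exact congrArg toBlocks₂₂ h

/-- Block elimination by elements of the algebra: `Q` turns the chosen minor into the identity, the
lower left block of `g` kills the upper left block of the form, and `1 - N` clears the remaining
columns in `U`. -/
theorem exists_normalized_of_isUnit_det (he : Function.Injective e)
    (hrefl : ∀ k, R k k) (htrans : ∀ i j k, R i j → R j k → R i k)
    (hU : ∀ k l, R k l → U l → U k) (hT : ∀ s, U (e s))
    (hfull : ∀ s k, U k → k ∉ Set.range e → R (e s) k)
    (F : Matrix (σ ⊕ κ) (σ ⊕ κ) ℂ) (hF : IsUnit (F.toBlocks₁₂.submatrix id e).det) :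
    ∃ B C D, (∀ s k, U k → B s k = inclMatrix e s k) ∧
      finrank ℂ (relStabilizer (glueRel R U) (fromBlocks 0 B C D)) ≤
        finrank ℂ (relStabilizer (glueRel R U) F) := by
  classical
  set Q := F.toBlocks₁₂.submatrix id e with hQ
  set A := F.toBlocks₁₁
  set E : Matrix κ σ ℂ := (inclMatrix e)ᵀ with hE
  have hmulE : ∀ (M : Matrix σ κ ℂ), M * E = M.submatrix id e := by
    intro M
    ext s s'
    simp [mul_apply, hE, inclMatrix]
  have hQQ : Q * Q⁻¹ = 1 := mul_nonsing_inv _ hF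
  have hQQ' : Q⁻¹ * Q = 1 := nonsing_inv_mul _ hF
  set B' : Matrix σ κ ℂ := Q⁻¹ * F.toBlocks₁₂ with hB'
  have hB'E : B' * E = 1 := by rw [hB', Matrix.mul_assoc, hmulE, ← hQ, hQQ']
  set B'' : Matrix σ κ ℂ := of fun s l => if U l ∧ l ∉ Set.range e then B' s l else 0 with hB''
  have hB''E : B'' * E = 0 := by
    rw [hmulE]
    ext s s'
    simp [hB'']
  set N : Matrix κ κ ℂ := E * B'' with hN
  have hNE : N * E = 0 := by rw [hN, Matrix.mul_assoc, hB''E, Matrix.mul_zero]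
  have hNN : N * N = 0 := by
    rw [hN, Matrix.mul_assoc, ← Matrix.mul_assoc B'', hB''E, Matrix.zero_mul, Matrix.mul_zero]
  have hB'N : B' * N = B'' := by rw [hN, ← Matrix.mul_assoc, hB'E, Matrix.one_mul]
  -- `B''` keeps only columns in `U` outside the range of `e`; this is what makes `N` an element of
  -- the algebra.
  have hNR : ∀ k l, N k l ≠ 0 → R k l := by
    intro k l hne
    obtain ⟨s, rfl, hs⟩ := exists_of_transpose_inclMatrix_mul_ne_zero hne
    rw [hB'', of_apply] at hs
    have h := (ite_ne_right_iff.1 hs).1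
    exact hfull s l h.1 h.2
  have hone : (1 : Matrix κ κ ℂ) ∈ relSupported R := by
    intro k l hne
    rw [one_apply] at hne
    rw [(ite_ne_right_iff.1 hne).1]
    exact hrefl l
  set g := fromBlocks Q 0 (-(E * (Q⁻¹ * A * Q))) (1 - N) with hg
  set h := fromBlocks Q⁻¹ 0 (E * (Q⁻¹ * A)) (1 + N) with hh
  have hgh : g * h = 1 := by
    rw [hg, hh, fromBlocks_multiply, ← fromBlocks_one]
    congr 1
    · rw [hQQ, Matrix.zero_mul, add_zero]
    · rw [Matrix.mul_zero, Matrix.zero_mul, add_zero]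
    · rw [Matrix.neg_mul, Matrix.mul_assoc E, Matrix.mul_assoc _ Q, hQQ, Matrix.mul_one,
        ← Matrix.mul_assoc (1 - N), Matrix.sub_mul, hNE, Matrix.one_mul, sub_zero, neg_add_cancel]
    · rw [Matrix.mul_zero, zero_add, show (1 - N) * (1 + N) = 1 - N * N by noncomm_ring, hNN,
        sub_zero]
  have hgR : g ∈ relSupported (glueRel R U) := by
    rw [hg, mem_relSupported_glueRel]
    refine ⟨rfl, fun k s hne => ?_, sub_mem hone hNR⟩
    obtain ⟨s', rfl, -⟩ := exists_of_transpose_inclMatrix_mul_ne_zero (neg_ne_zero.1 hne)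
    exact hT s'
  have hhR : h ∈ relSupported (glueRel R U) := by
    rw [hh, mem_relSupported_glueRel]
    refine ⟨rfl, fun k s hne => ?_, add_mem hone hNR⟩
    obtain ⟨s', rfl, -⟩ := exists_of_transpose_inclMatrix_mul_ne_zero hne
    exact hT s'
  have hconj := finrank_relStabilizer_le_conj (glueRel_trans htrans hU) F hgR hhR hgh
  have h11 : (h * F * g).toBlocks₁₁ = 0 := by
    rw [← fromBlocks_toBlocks F, hg, hh, fromBlocks_multiply, fromBlocks_multiply,
      toBlocks_fromBlocks₁₁, Matrix.zero_mul, add_zero, Matrix.zero_mul, add_zero, ← hB',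
      Matrix.mul_neg, ← Matrix.mul_assoc B', hB'E, Matrix.one_mul, add_neg_cancel]
  have h12 : (h * F * g).toBlocks₁₂ = B' - B'' := by
    rw [← fromBlocks_toBlocks F, hg, hh, fromBlocks_multiply, fromBlocks_multiply,
      toBlocks_fromBlocks₁₂, Matrix.mul_zero, zero_add, Matrix.zero_mul, add_zero, ← hB',
      Matrix.mul_sub, Matrix.mul_one, hB'N]
  refine ⟨B' - B'', (h * F * g).toBlocks₂₁, (h * F * g).toBlocks₂₂, fun s k hk => ?_, ?_⟩
  · rw [Matrix.sub_apply, hB'', of_apply]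
    by_cases hkT : k ∈ Set.range e
    · obtain ⟨s', rfl⟩ := hkT
      rw [if_neg (fun h => h.2 ⟨s', rfl⟩), sub_zero]
      have := congrFun (congrFun hB'E s) s'
      rw [hmulE, submatrix_apply, id_eq, one_apply] at this
      rw [this, inclMatrix]
      simp only [he.eq_iff, eq_comm]
    · rw [if_pos ⟨hk, hkT⟩, sub_self, inclMatrix, if_neg (fun h => hkT ⟨s, h.symm⟩)]
  · rwa [← h12, ← h11, fromBlocks_toBlocks]

theorem eventually_eval_ne_zero {p : Polynomial ℂ} (hp : p ≠ 0) :
    ∀ᶠ t in 𝓝[≠] (0 : ℂ), p.eval t ≠ 0 := by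
  have hfin : {t | p.IsRoot t}.Finite := Polynomial.finite_setOfPred_isRoot hp
  have hcl : IsClosed ({t | p.IsRoot t} \ {0}) := (hfin.subset Set.sdiff_subset).isClosed
  have h0 : ∀ᶠ t in 𝓝 (0 : ℂ), t ∈ ({t | p.IsRoot t} \ {0})ᶜ :=
    hcl.isOpen_compl.mem_nhds (fun h => h.2 rfl)
  rw [eventually_nhdsWithin_iff]
  filter_upwards [h0] with t ht ht0 hroot
  exact ht ⟨hroot, ht0⟩

/-- An optimal form for the smaller relation extends to a normalized one, which gives one
inequality. For the other, any form is perturbed until its minor is invertible, then normalized. -/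
theorem relIndex_glueRel (he : Function.Injective e)
    (hrefl : ∀ k, R k k) (htrans : ∀ i j k, R i j → R j k → R i k)
    (hU : ∀ k l, R k l → U l → U k) (hT : ∀ s, U (e s))
    (hfull : ∀ s k, U k → k ∉ Set.range e → R (e s) k) :
    relIndex (glueRel R U : σ ⊕ κ → σ ⊕ κ → Prop) =
      relIndex (fun k l => R k l ∧ ¬(k ∈ Set.range e ∧ U l ∧ l ∉ Set.range e)) := by
  refine le_antisymm ?_ (le_relIndex fun F => ?_)
  · obtain ⟨D, hD⟩ := exists_relIndex_eq
      (fun k l => R k l ∧ ¬(k ∈ Set.range e ∧ U l ∧ l ∉ Set.range e))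
    rw [← hD]
    exact (relIndex_le _ _).trans (finrank_relStabilizer_le_of_normalized he hT hfull 0 D)
  · set Q := F.toBlocks₁₂.submatrix id e
    -- Adding `t • inclMatrix e` changes the minor to `Q + t`, with determinant the characteristic
    -- polynomial of `-Q` at `t`.
    have hdet : ∀ᶠ t in 𝓝[≠] (0 : ℂ), (Matrix.scalar σ t - -Q).det ≠ 0 := by
      filter_upwards [eventually_eval_ne_zero (-Q).charpoly_monic.ne_zero] with t ht
      rwa [eval_charpoly] at ht
    have hev := (eventually_finrank_relStabilizer_le (glueRel R U) F
      (fromBlocks 0 (inclMatrix e) 0 0)).filter_mono (nhdsWithin_le_nhds (s := {0}ᶜ))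
    obtain ⟨t, ht, ht'⟩ := (hdet.and hev).exists
    obtain ⟨B, C, D, hB, hle⟩ := exists_normalized_of_isUnit_det he hrefl htrans hU hT hfull
      (F + t • fromBlocks 0 (inclMatrix e) 0 0) (by
        rw [isUnit_iff_ne_zero]
        convert ht using 2
        ext s s'
        simp [toBlocks₁₂, inclMatrix, Q, he.eq_iff, Matrix.scalar_apply,
          diagonal_apply, eq_comm, add_comm])
    exact (relIndex_le _ D).trans ((finrank_relStabilizer_ge_of_normalized he hU B C D
      hB).trans (hle.trans ht'))

end Reduction

/-! ### Relabelling, transposition and splitting off a full matrix algebra -/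

theorem relIndex_comp_equiv_le {ι ι' : Type*} [Fintype ι] [Fintype ι'] (e : ι ≃ ι')
    (R : ι' → ι' → Prop) : relIndex (fun i j => R (e i) (e j)) ≤ relIndex R := by
  obtain ⟨F, hF⟩ := exists_relIndex_eq R
  rw [← hF]
  refine (relIndex_le _ (F.submatrix e e)).trans
    (finrank_le_of_injOn (reindexLinearEquiv ℂ ℂ e e).toLinearMap _ _ ?_ ?_)
  · intro x hx
    obtain ⟨y, rfl⟩ : ∃ y : Matrix ι' ι' ℂ, x = y.submatrix e e :=
      ⟨x.submatrix e.symm e.symm, by ext; simp⟩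
    simp only [LinearEquiv.coe_coe, coe_reindexLinearEquiv, reindex_apply, submatrix_submatrix,
      Equiv.self_comp_symm, submatrix_id_id]
    refine ⟨fun i j hne => ?_, fun i j hij => ?_⟩
    · have := hx.1 (e.symm i) (e.symm j) (by simpa using hne)
      simpa using this
    · have := hx.2 (e.symm i) (e.symm j) (by simpa using hij)
      rw [submatrix_mul_equiv, submatrix_mul_equiv] at this
      simpa using this
  · intro x _ hx
    exact (LinearEquiv.map_eq_zero_iff _).1 hx

theorem relIndex_comp_equiv {ι ι' : Type*} [Fintype ι] [Fintype ι'] (e : ι ≃ ι')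
    (R : ι' → ι' → Prop) : relIndex (fun i j => R (e i) (e j)) = relIndex R := by
  refine le_antisymm (relIndex_comp_equiv_le e R) ?_
  simpa using relIndex_comp_equiv_le e.symm fun i j => R (e i) (e j)

theorem relIndex_swap_le {ι : Type*} [Fintype ι] (R : ι → ι → Prop) :
    relIndex (fun i j => R j i) ≤ relIndex R := by
  obtain ⟨F, hF⟩ := exists_relIndex_eq R
  rw [← hF]
  refine (relIndex_le _ Fᵀ).trans
    (finrank_le_of_injOn (transposeLinearEquiv ι ι ℂ ℂ).toLinearMap _ _ ?_ ?_)
  · intro x hx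
    refine ⟨fun i j hne => hx.1 j i hne, fun i j hij => ?_⟩
    have h := hx.2 j i hij
    rw [← transpose_apply (Fᵀ * x), ← transpose_apply (x * Fᵀ), transpose_mul, transpose_mul,
      transpose_transpose] at h
    exact h.symm
  · intro x _ hx
    exact (LinearEquiv.map_eq_zero_iff _).1 hx

theorem relIndex_swap {ι : Type*} [Fintype ι] (R : ι → ι → Prop) :
    relIndex (fun i j => R j i) = relIndex R :=
  le_antisymm (relIndex_swap_le R) (relIndex_swap_le fun i j => R j i)

/-- A product of submodules, as a module. -/
def submoduleProdEquiv {V W : Type*} [AddCommGroup V] [Module ℂ V] [AddCommGroup W] [Module ℂ W]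
    (S : Submodule ℂ V) (T : Submodule ℂ W) : S.prod T ≃ₗ[ℂ] S × T where
  toFun x := (⟨x.1.1, x.2.1⟩, ⟨x.1.2, x.2.2⟩)
  map_add' _ _ := rfl
  map_smul' _ _ := rfl
  invFun p := ⟨(p.1.1, p.2.1), p.1.2, p.2.2⟩
  left_inv _ := rfl
  right_inv _ := rfl

theorem finrank_relStabilizer_glueRel_false {σ κ : Type*} [Fintype σ] [Fintype κ]
    (R : κ → κ → Prop) (A : Matrix σ σ ℂ) (B : Matrix σ κ ℂ) (C : Matrix κ σ ℂ)
    (D : Matrix κ κ ℂ) :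
    finrank ℂ (relStabilizer (glueRel R fun _ => False) (fromBlocks A B C D)) =
      finrank ℂ (relStabilizer (fun _ _ => True) A) + finrank ℂ (relStabilizer R D) := by
  have hprod : finrank ℂ ((relStabilizer (fun _ _ => True) A).prod (relStabilizer R D)) =
      finrank ℂ (relStabilizer (fun _ _ => True) A) + finrank ℂ (relStabilizer R D) := by
    rw [← finrank_prod]
    exact (submoduleProdEquiv _ _).finrank_eq
  rw [← hprod]
  refine le_antisymm (finrank_le_of_injOn
    { toFun := fun x => (x.toBlocks₁₁, x.toBlocks₂₂), map_add' := ?_, map_smul' := ?_ } _ _ ?_ ?_)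
    (finrank_le_of_injOn
    { toFun := fun p : Matrix σ σ ℂ × Matrix κ κ ℂ => fromBlocks p.1 0 0 p.2,
      map_add' := ?_, map_smul' := ?_ } _ _ ?_ ?_)
  · intro x y; rfl
  · intro c x; rfl
  · intro x hx
    rw [← fromBlocks_toBlocks x, mem_relStabilizer_glueRel] at hx
    obtain ⟨-, hZ, hY, h1, -, h3⟩ := hx
    have hZ0 : x.toBlocks₂₁ = 0 := by
      ext k s
      by_contra hne
      exact hZ k s hne
    rw [hZ0, Matrix.mul_zero, add_zero] at h1
    rw [hZ0, Matrix.zero_mul, zero_add] at h3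
    exact ⟨⟨fun _ _ _ => trivial, fun i j _ => congrFun (congrFun h1 j) i⟩, hY, h3⟩
  · intro x hx hx0
    rw [← fromBlocks_toBlocks x, mem_relStabilizer_glueRel] at hx
    obtain ⟨hW, hZ, -, -, -, -⟩ := hx
    have hZ0 : x.toBlocks₂₁ = 0 := by
      ext k s
      by_contra hne
      exact hZ k s hne
    have h11 : x.toBlocks₁₁ = 0 := congrArg Prod.fst hx0
    have h22 : x.toBlocks₂₂ = 0 := congrArg Prod.snd hx0
    rw [← fromBlocks_toBlocks x, hW, hZ0, h11, h22, fromBlocks_zero]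
  · intro p q
    rw [fromBlocks_add, add_zero, add_zero]
    rfl
  · intro c p
    rw [RingHom.id_apply, fromBlocks_smul, smul_zero, smul_zero]
    rfl
  · rintro ⟨X, Y⟩ ⟨hX, hY⟩
    simp only [LinearMap.coe_mk, AddHom.coe_mk]
    rw [mem_relStabilizer_glueRel]
    refine ⟨rfl, fun k s hne => hne rfl, hY.1, ?_, fun _ _ h => h.elim, ?_⟩
    · rw [Matrix.mul_zero, add_zero]
      ext i j
      exact hX.2 j i trivial
    · rw [Matrix.zero_mul, zero_add]
      exact hY.2
  · rintro ⟨X, Y⟩ _ h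
    have h' : fromBlocks X 0 0 Y = 0 := h
    exact Prod.ext (congrArg toBlocks₁₁ h') (congrArg toBlocks₂₂ h')

theorem card_le_finrank_of_det_ne_zero {σ : Type*} [Fintype σ] [DecidableEq σ]
    (S : Submodule ℂ (Matrix σ σ ℂ)) (v : σ → S)
    (h : (Matrix.of fun k i => (v k).1 i i).det ≠ 0) : Fintype.card σ ≤ finrank ℂ S := by
  have hli : LinearIndependent ℂ v :=
    LinearIndependent.of_comp (diagLinearMap σ ℂ ℂ ∘ₗ S.subtype)
      (linearIndependent_rows_of_det_ne_zero h)
  exact hli.fintype_card_le_finrank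

/-- By semicontinuity `F` may be replaced by `F + t • D` with `D` diagonal with distinct entries.
Powers of `t⁻¹ • F + D` commute with it, and for generic `t` their diagonals are independent. -/
theorem card_le_finrank_centralizer {σ : Type*} [Fintype σ] (F : Matrix σ σ ℂ) :
    Fintype.card σ ≤ finrank ℂ (relStabilizer (fun _ _ => True) F) := by
  classical
  let m : σ → ℕ := fun s => (Fintype.equivFin σ s : ℕ)
  let D : Matrix σ σ ℂ := diagonal fun s => (m s : ℂ)
  let P : Polynomial ℂ := (Matrix.of fun k i =>
    (((Polynomial.X : Polynomial ℂ) • F.map Polynomial.C + D.map Polynomial.C) ^ m k) i i).det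
  have heval : ∀ t, P.eval t = (Matrix.of fun k i => ((t • F + D) ^ m k) i i).det := by
    intro t
    rw [← Polynomial.coe_evalRingHom, RingHom.map_det]
    congr 1
    ext k i
    have h1 : (Polynomial.evalRingHom t).mapMatrix
        ((Polynomial.X : Polynomial ℂ) • F.map Polynomial.C + D.map Polynomial.C) = t • F + D := by
      ext i j
      simp
      exact mul_comm _ _
    simp only [of_apply]
    rw [← h1, ← map_pow]
    rfl
  -- At 0 the determinant is Vandermonde in the distinct diagonal entries of `D`.
  have hP : P ≠ 0 := by
    intro h
    have h0 := heval 0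
    rw [h, Polynomial.eval_zero, zero_smul, zero_add] at h0
    have h1 : (Matrix.of fun k i => (D ^ m k) i i) =
        ((vandermonde fun s : Fin (Fintype.card σ) => ((s : ℕ) : ℂ))ᵀ).submatrix
          (Fintype.equivFin σ) (Fintype.equivFin σ) := by
      ext k i
      simp [D, m, diagonal_pow, vandermonde_apply]
    rw [h1, det_submatrix_equiv_self, det_transpose, eq_comm, det_vandermonde_eq_zero_iff] at h0
    obtain ⟨i, j, hij, hne⟩ := h0
    exact hne (Fin.ext (by exact_mod_cast hij))
  -- The finitely many roots of `P` are bounded, and `t⁻¹` leaves every bounded set as `t` tends to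
  -- 0.
  have hroot : ∀ᶠ t in 𝓝[≠] (0 : ℂ), P.eval t⁻¹ ≠ 0 := by
    refine tendsto_inv₀_nhdsNE_zero.eventually (p := fun s => P.eval s ≠ 0) ?_
    have := (Polynomial.finite_setOfPred_isRoot hP).isBounded
    exact Bornology.isBounded_def.1 this
  have hev := (eventually_finrank_relStabilizer_le (fun _ _ => True) F D).filter_mono
    (nhdsWithin_le_nhds (s := {0}ᶜ))
  have hne : ∀ᶠ t in 𝓝[≠] (0 : ℂ), t ≠ 0 := eventually_mem_nhdsWithin
  obtain ⟨t, ⟨ht1, ht2⟩, ht0⟩ := ((hroot.and hev).and hne).exists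
  refine le_trans ?_ ht2
  rw [heval] at ht1
  refine card_le_finrank_of_det_ne_zero _ (fun k => ⟨(t⁻¹ • F + D) ^ m k, ?_⟩) ht1
  refine ⟨fun _ _ _ => trivial, fun i j _ => ?_⟩
  have hF : F + t • D = t • (t⁻¹ • F + D) := by
    rw [smul_add, smul_smul, mul_inv_cancel₀ ht0, one_smul]
  rw [hF, Matrix.smul_mul, Matrix.mul_smul, ← pow_succ, ← pow_succ']

theorem exists_finrank_centralizer_eq (σ : Type*) [Fintype σ] :
    ∃ F : Matrix σ σ ℂ, finrank ℂ (relStabilizer (fun _ _ => True) F) = Fintype.card σ := by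
  classical
  let d : σ → ℂ := fun s => ((Fintype.equivFin σ s : ℕ) : ℂ)
  refine ⟨diagonal d, le_antisymm ?_ (card_le_finrank_centralizer _)⟩
  rw [← finrank_fintype_fun_eq_card (R := ℂ), ← finrank_top ℂ (σ → ℂ)]
  refine finrank_le_of_injOn (diagLinearMap σ ℂ ℂ) _ _ (fun _ _ => trivial) fun x hx h0 => ?_
  ext i j
  by_cases hij : i = j
  · rw [← hij]
    exact congrFun h0 i
  · have := hx.2 j i trivial
    rw [diagonal_mul, mul_diagonal] at this
    have hd : d i ≠ d j := by
      intro h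
      have h' : (Fintype.equivFin σ i : ℕ) = Fintype.equivFin σ j := Nat.cast_injective h
      exact hij ((Fintype.equivFin σ).injective (Fin.ext h'))
    have h1 : (d i - d j) * x i j = 0 := by linear_combination this
    exact (mul_eq_zero.1 h1).resolve_left (sub_ne_zero.2 hd)

theorem relIndex_glueRel_false {σ κ : Type*} [Fintype σ] [Fintype κ] (R : κ → κ → Prop) :
    relIndex (glueRel R fun _ => False : σ ⊕ κ → σ ⊕ κ → Prop) =
      Fintype.card σ + relIndex R := by
  refine le_antisymm ?_ (le_relIndex fun F => ?_)
  · obtain ⟨A, hA⟩ := exists_finrank_centralizer_eq σ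
    obtain ⟨D, hD⟩ := exists_relIndex_eq R
    rw [← hA, ← hD, ← finrank_relStabilizer_glueRel_false R A 0 0 D]
    exact relIndex_le _ _
  · rw [← fromBlocks_toBlocks F, finrank_relStabilizer_glueRel_false]
    exact add_le_add (card_le_finrank_centralizer _) (relIndex_le _ _)

/-! ### The index of a seaweed algebra as the index of a relation -/

namespace Meander

theorem finrank_coadjointStabilizer {n : ℕ} (m : Meander n) (f : Dual ℂ (m.seaweed ℂ))
    (F : Matrix (Fin n) (Fin n) ℂ) (hf : ∀ x : m.seaweed ℂ, f x = trace (F * x.1)) :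
    finrank ℂ (coadjointStabilizer ℂ f) = finrank ℂ (relStabilizer m.Allowed F) := by
  let incl : m.seaweed ℂ →ₗ[ℂ] Matrix (Fin n) (Fin n) ℂ := (m.seaweed ℂ).incl
  have hincl : Function.Injective incl := Subtype.val_injective
  rw [((coadjointStabilizer ℂ f).equivMapOfInjective incl hincl).finrank_eq]
  suffices h : (coadjointStabilizer ℂ f).map incl = relStabilizer m.Allowed F by rw [h]
  ext x
  rw [mem_relStabilizer_iff_trace]
  constructor
  · rintro ⟨x, hx, rfl⟩
    refine ⟨x.2, fun y hy => ?_⟩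
    have := hx ⟨y, hy⟩
    rwa [hf] at this
  · rintro ⟨hx, h⟩
    refine ⟨⟨x, hx⟩, fun y => ?_, rfl⟩
    rw [hf]
    exact h y.1 y.2

theorem exists_trace_form {n : ℕ} (f : Dual ℂ (Matrix (Fin n) (Fin n) ℂ)) :
    ∃ F : Matrix (Fin n) (Fin n) ℂ, ∀ x, f x = trace (F * x) := by
  refine ⟨Matrix.of fun i j => f (single j i 1), fun x => ?_⟩
  have h : f = traceLinearMap (Fin n) ℂ ℂ ∘ₗ
      LinearMap.mulLeft ℂ (Matrix.of fun i j => f (single j i 1)) := by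
    refine Matrix.ext_linearMap _ fun i j => LinearMap.ext_ring ?_
    simp [trace_mul_single]
  exact LinearMap.congr_fun h x

theorem ind_eq_relIndex {n : ℕ} (m : Meander n) : m.ind = relIndex m.Allowed := by
  refine le_antisymm (le_relIndex fun F => ?_) ?_
  · let f : Dual ℂ (m.seaweed ℂ) := traceLinearMap (Fin n) ℂ ℂ ∘ₗ LinearMap.mulLeft ℂ F ∘ₗ
      (m.seaweed ℂ).toSubmodule.subtype
    rw [← finrank_coadjointStabilizer m f F fun _ => rfl]
    exact ciInf_le (OrderBot.bddBelow _) f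
  · refine le_ciInf fun f => ?_
    obtain ⟨g, hg⟩ := LinearMap.exists_extend (p := (m.seaweed ℂ).toSubmodule) f
    obtain ⟨F, hF⟩ := exists_trace_form g
    rw [finrank_coadjointStabilizer m f F fun x => by rw [← hF, ← hg]; rfl]
    exact relIndex_le _ _

end Meander

end

/-! ### Reductions of the index in terms of block lists -/

/-- The number of the block of a list of block sizes that contains position `i`. -/
def blockIndex : List ℕ → ℕ → ℕ
  | [], _ => 0
  | a :: L, i => if i < a then 0 else blockIndex L (i - a) + 1

theorem blockIndex_of_lt {a i : ℕ} (L : List ℕ) (h : i < a) : blockIndex (a :: L) i = 0 :=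
  if_pos h

theorem blockIndex_add (a i : ℕ) (L : List ℕ) :
    blockIndex (a :: L) (a + i) = blockIndex L i + 1 := by
  rw [blockIndex, if_neg (by omega), Nat.add_sub_cancel_left]

theorem blockIndex_mono (L : List ℕ) {i j : ℕ} (h : i ≤ j) : blockIndex L i ≤ blockIndex L j := by
  induction L generalizing i j with
  | nil => exact le_rfl
  | cons a L ih =>
    rw [blockIndex, blockIndex]
    have := @ih (i - a) (j - a) (by omega)
    split_ifs <;> omega

theorem blockIndex_eq_of_sum_take {L : List ℕ} {i k : ℕ} (h1 : (L.take k).sum ≤ i)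
    (h2 : i < (L.take (k + 1)).sum) : blockIndex L i = k := by
  induction L generalizing i k with
  | nil => simp at h2
  | cons a L ih =>
    cases k with
    | zero =>
      rw [List.take_succ_cons, List.take_zero, List.sum_singleton] at h2
      exact blockIndex_of_lt L h2
    | succ k =>
      rw [List.take_succ_cons, List.sum_cons] at h1 h2
      obtain ⟨j, rfl⟩ : ∃ j, i = a + j := ⟨i - a, by omega⟩
      rw [blockIndex_add, ih (Nat.le_of_add_le_add_left h1) (Nat.lt_of_add_lt_add_left h2)]

theorem Composition.index_eq_blockIndex {n : ℕ} (c : Composition n) (i : Fin n) :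
    (c.index i : ℕ) = blockIndex c.blocks i :=
  (blockIndex_eq_of_sum_take (c.sizeUpTo_index_le i) (c.lt_sizeUpTo_index_succ i)).symm

/-- The positions of the seaweed algebra with upper blocks `L` and lower blocks `M`. -/
def listRel (L M : List ℕ) (i j : ℕ) : Prop :=
  (i < j → blockIndex L i = blockIndex L j) ∧ (j < i → blockIndex M i = blockIndex M j)

theorem listRel_trans (L M : List ℕ) {i j k : ℕ} (h : listRel L M i j) (h' : listRel L M j k) :
    listRel L M i k := by
  have hL : ∀ {a b : ℕ}, a ≤ b → blockIndex L a ≤ blockIndex L b := blockIndex_mono L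
  have hM : ∀ {a b : ℕ}, a ≤ b → blockIndex M a ≤ blockIndex M b := blockIndex_mono M
  obtain ⟨h1, h2⟩ := h
  obtain ⟨h3, h4⟩ := h'
  have a1 := @hL i j
  have a2 := @hL j k
  have a3 := @hL k j
  have a4 := @hL j i
  have b1 := @hM i j
  have b2 := @hM j k
  have b3 := @hM k j
  have b4 := @hM j i
  have e1 : i = j → blockIndex L i = blockIndex L j := fun h => by rw [h]
  have e2 : j = k → blockIndex L j = blockIndex L k := fun h => by rw [h]
  have e3 : i = j → blockIndex M i = blockIndex M j := fun h => by rw [h]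
  have e4 : j = k → blockIndex M j = blockIndex M k := fun h => by rw [h]
  have c1 := @hL i k
  have c2 := @hM k i
  constructor
  · intro hik
    rcases lt_trichotomy i j with h | h | h <;> rcases lt_trichotomy j k with h' | h' | h' <;> omega
  · intro hki
    rcases lt_trichotomy i j with h | h | h <;> rcases lt_trichotomy j k with h' | h' | h' <;> omega

/-- The index of the seaweed algebra of size `n` with upper blocks `L` and lower blocks `M`. -/
noncomputable def listIndex (n : ℕ) (L M : List ℕ) : ℕ :=
  relIndex fun i j : Fin n => listRel L M i j

theorem Meander.ind_eq_listIndex {n : ℕ} (m : Meander n) :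
    m.ind = listIndex n m.1.blocks m.2.blocks := by
  rw [Meander.ind_eq_relIndex, listIndex]
  congr 1
  funext i j
  simp only [Meander.Allowed, listRel, ← Composition.index_eq_blockIndex, Fin.ext_iff,
    Fin.lt_def]

theorem listIndex_swap (n : ℕ) (L M : List ℕ) : listIndex n M L = listIndex n L M := by
  rw [listIndex, ← relIndex_swap, listIndex]
  congr 1
  funext i j
  exact propext ⟨fun h => ⟨fun hl => (h.2 hl).symm, fun hl => (h.1 hl).symm⟩,
    fun h => ⟨fun hl => (h.2 hl).symm, fun hl => (h.1 hl).symm⟩⟩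

theorem listIndex_zero (L M : List ℕ) : listIndex 0 L M = 0 := by
  refine Nat.le_zero.1 ((relIndex_le _ 0).trans ?_)
  rw [Module.finrank_zero_of_subsingleton]

theorem listIndex_zero_cons (n : ℕ) (L M : List ℕ) : listIndex n L (0 :: M) = listIndex n L M := by
  have h : ∀ i, blockIndex (0 :: M) i = blockIndex M i + 1 := by
    intro i
    simpa using blockIndex_add 0 i M
  simp only [listIndex, listRel, h, add_left_inj]

theorem listIndex_cons_self (a n : ℕ) (L M : List ℕ) :
    listIndex (a + n) (a :: L) (a :: M) = a + listIndex n L M := by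
  have key := relIndex_glueRel_false (σ := Fin a) fun i j : Fin n => listRel L M i j
  rw [Fintype.card_fin] at key
  rw [listIndex, listIndex, ← key, ← relIndex_comp_equiv finSumFinEquiv]
  congr 1
  funext x y
  rcases x with i | i <;> rcases y with j | j <;>
    simp only [finSumFinEquiv_apply_left, finSumFinEquiv_apply_right, Fin.val_castAdd,
      Fin.val_natAdd, listRel, glueRel, blockIndex_add, blockIndex_of_lt _ i.2,
      blockIndex_of_lt _ j.2, eq_iff_iff]
  · simp
  · have := i.2
    grind
  · have := j.2
    grind
  · simp

/-- `relIndex_glueRel` with the first `a` positions as `σ`. The rest of the first lower block is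
`U`, and `e` hits its last `a` positions. The pairs removed from the relation lead from these to the
`d` positions before them, so that the block `d + a` is cut into `d` and `a`. -/
theorem listIndex_cons_of_two_mul_le (a d n : ℕ) (L M : List ℕ) (hn : d + a ≤ n) :
    listIndex (a + n) (a :: L) ((2 * a + d) :: M) = listIndex n L (d :: a :: M) := by
  let e : Fin a → Fin n := fun s => ⟨d + s, by omega⟩
  have key := relIndex_glueRel (σ := Fin a) (κ := Fin n)
    (R := fun i j => listRel L ((d + a) :: M) i j) (U := fun i => (i : ℕ) < d + a)
    (e := e) (fun s s' h => by simpa [e, Fin.ext_iff] using h)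
    (fun k => ⟨fun h => absurd h (lt_irrefl _), fun h => absurd h (lt_irrefl _)⟩)
    (fun i j k h h' => listRel_trans _ _ h h') (fun k l h hl => by
      by_contra hk
      have h1 := h.2 (by omega)
      obtain ⟨t, ht⟩ : ∃ t, (k : ℕ) = d + a + t := ⟨k - (d + a), by omega⟩
      rw [ht, blockIndex_add, blockIndex_of_lt _ hl] at h1
      omega)
    (fun s => by simp [e]) (fun s k hk hkr => by
      have hkd : (k : ℕ) < d := by
        by_contra h
        exact hkr ⟨⟨k - d, by omega⟩, Fin.ext (by simp [e]; omega)⟩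
      have hes : (e s : ℕ) = d + s := rfl
      refine ⟨fun h => by omega, fun _ => ?_⟩
      rw [blockIndex_of_lt _ hk, blockIndex_of_lt _ (by omega)])
  have h1 : listIndex (a + n) (a :: L) ((2 * a + d) :: M) = relIndex (glueRel
      (fun i j : Fin n => listRel L ((d + a) :: M) i j) (fun i => (i : ℕ) < d + a) :
        Fin a ⊕ Fin n → Fin a ⊕ Fin n → Prop) := by
    rw [listIndex, ← relIndex_comp_equiv finSumFinEquiv]
    congr 1
    funext x y
    have hb : ∀ i, blockIndex ((2 * a + d) :: M) (a + i) = blockIndex ((d + a) :: M) i := by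
      intro i
      rw [blockIndex, blockIndex, show a + i - (2 * a + d) = i - (d + a) by omega]
      split_ifs <;> omega
    rcases x with i | i <;> rcases y with j | j <;>
      simp only [finSumFinEquiv_apply_left, finSumFinEquiv_apply_right, Fin.val_castAdd,
        Fin.val_natAdd, listRel, glueRel, blockIndex_add, hb, eq_iff_iff]
    · simp only [blockIndex_of_lt _ i.2, blockIndex_of_lt _ j.2, iff_true]
      have := i.2
      have := j.2
      rw [blockIndex_of_lt _ (by omega), blockIndex_of_lt _ (by omega)]
      simp
    · have := i.2
      rw [blockIndex_of_lt L i.2]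
      grind
    · have := j.2
      rw [blockIndex_of_lt (a := 2 * a + d) _ (by omega)]
      rcases lt_or_ge (i : ℕ) (d + a) with h | h
      · rw [blockIndex_of_lt _ h]
        omega
      · obtain ⟨t, ht⟩ : ∃ t, (i : ℕ) = d + a + t := ⟨i - (d + a), by omega⟩
        rw [ht, blockIndex_add]
        grind
    · simp
  rw [h1, key, listIndex]
  congr 1
  funext k l
  have hr : ∀ k : Fin n, k ∈ Set.range e ↔ d ≤ (k : ℕ) ∧ (k : ℕ) < d + a := by
    intro k
    constructor
    · rintro ⟨s, rfl⟩
      have := s.2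
      simp only [e]
      omega
    · rintro ⟨h1, h2⟩
      exact ⟨⟨k - d, by omega⟩, Fin.ext (by simp [e]; omega)⟩
  have hb : ∀ i, blockIndex ((d + a) :: M) i =
      if i < d + a then 0 else blockIndex M (i - (d + a)) + 1 := fun i => rfl
  have hb' : ∀ i, blockIndex (d :: a :: M) i =
      if i < d then 0 else if i < d + a then 1 else blockIndex M (i - (d + a)) + 2 := by
    intro i
    rw [blockIndex, blockIndex, Nat.sub_sub]
    split_ifs <;> omega
  simp only [listRel, hr, hb, hb', eq_iff_iff]
  generalize blockIndex M (k - (d + a)) = u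
  generalize blockIndex M (l - (d + a)) = v
  generalize blockIndex L k = u'
  generalize blockIndex L l = v'
  split_ifs <;> grind

/-! ### The rules for parts 1 and 4, and homogeneity of the index -/

/-- The index of the seaweed algebra with block sizes `L` and `M` multiplied by `c`. -/
noncomputable def scaledIndex (c : ℕ) (L M : List ℕ) : ℕ :=
  listIndex (c * L.sum) (L.map (c * ·)) (M.map (c * ·))

theorem scaledIndex_swap (c : ℕ) {L M : List ℕ} (h : L.sum = M.sum) :
    scaledIndex c M L = scaledIndex c L M := by
  rw [scaledIndex, scaledIndex, listIndex_swap, h]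

theorem scaledIndex_nil (c : ℕ) (M : List ℕ) : scaledIndex c [] M = 0 :=
  listIndex_zero _ _

theorem scaledIndex_cons_self (c a : ℕ) (L M : List ℕ) :
    scaledIndex c (a :: L) (a :: M) = c * a + scaledIndex c L M := by
  rw [scaledIndex, List.sum_cons, mul_add, List.map_cons, List.map_cons, listIndex_cons_self]
  rfl

theorem scaledIndex_one_one_four (c : ℕ) (L M : List ℕ) (h : 2 ≤ L.sum) :
    scaledIndex c (1 :: 1 :: L) (4 :: M) = scaledIndex c L (1 :: 1 :: M) := by
  have hc : c * 2 ≤ c * L.sum := Nat.mul_le_mul_left c h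
  simp only [scaledIndex, List.sum_cons, mul_add, List.map_cons, mul_one]
  -- In units of c: 1|1|L over 4|M becomes 1|L over 2|1|M, then L over 0|1|1|M, and the empty block
  -- is dropped.
  rw [show c * 4 = 2 * c + 2 * c by ring, listIndex_cons_of_two_mul_le _ _ _ _ _ (by omega),
    ← add_zero (2 * c), listIndex_cons_of_two_mul_le _ _ _ _ _ (by omega), listIndex_zero_cons]

theorem scaledIndex_one_four_four (c : ℕ) (L M : List ℕ) (h : 1 + L.sum = M.sum) :
    scaledIndex c (1 :: 4 :: L) (4 :: M) = scaledIndex c (1 :: L) M := by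
  have hc : c * 1 + c * L.sum = c * M.sum := by rw [← mul_add, h]
  simp only [scaledIndex, List.sum_cons, mul_add, List.map_cons, mul_one]
  -- In units of c: 1|4|L over 4|M, then 4|L over 2|1|M; after exchanging the sides, 1|M over 2|L,
  -- then M over 1|L.
  rw [show c * 4 = 2 * c + 2 * c by ring, listIndex_cons_of_two_mul_le _ _ _ _ _ (by omega),
    listIndex_swap, show 2 * c + 2 * c = 2 * (2 * c) + 0 by ring,
    show 2 * (2 * c) + 0 + c * L.sum = 2 * c + (c + (c + c * L.sum)) by ring,
    listIndex_cons_of_two_mul_le _ _ _ _ _ (by omega), listIndex_zero_cons,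
    ← add_zero (2 * c), listIndex_cons_of_two_mul_le _ _ _ _ _ (by omega), listIndex_zero_cons,
    listIndex_swap]

/-- All entries of a list are `1` or `4`. -/
def OneFour (L : List ℕ) : Prop := ∀ p ∈ L, p = 1 ∨ p = 4

theorem oneFour_nil : OneFour [] := fun _ h => absurd h List.not_mem_nil

theorem oneFour_cons {a : ℕ} {L : List ℕ} : OneFour (a :: L) ↔ (a = 1 ∨ a = 4) ∧ OneFour L :=
  List.forall_mem_cons

/-- The three rules hold for every scale and decrease the sum. Only cancellation of equal first
parts contributes to the index, and that contribution is proportional to `c`. -/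
theorem scaledIndex_eq_mul (c : ℕ) {L M : List ℕ} (hL : OneFour L) (hM : OneFour M)
    (h : L.sum = M.sum) : scaledIndex c L M = c * scaledIndex 1 L M := by
  induction hn : L.sum using Nat.strong_induction_on generalizing L M with
  | _ n ih =>
    subst hn
    have step : ∀ A B : List ℕ, OneFour A → OneFour B → 1 + A.sum = 4 + B.sum →
        4 + B.sum = L.sum →
        scaledIndex c (1 :: A) (4 :: B) = c * scaledIndex 1 (1 :: A) (4 :: B) := by
      intro A B hA hB hs hl
      rcases A with _ | ⟨x, A⟩
      · simp at hs
        omega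
      · rw [oneFour_cons] at hA
        simp only [List.sum_cons] at hs
        rcases hA.1 with rfl | rfl
        · rw [scaledIndex_one_one_four _ _ _ (by omega), scaledIndex_one_one_four _ _ _ (by omega)]
          exact ih A.sum (by omega) hA.2
            (oneFour_cons.2 ⟨.inl rfl, oneFour_cons.2 ⟨.inl rfl, hB⟩⟩)
            (by simp only [List.sum_cons]; omega) rfl
        · rw [scaledIndex_one_four_four _ _ _ (by omega),
            scaledIndex_one_four_four _ _ _ (by omega)]
          exact ih (1 :: A).sum (by simp only [List.sum_cons]; omega)
            (oneFour_cons.2 ⟨.inl rfl, hA.2⟩) hB (by simp only [List.sum_cons]; omega) rfl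
    rcases L with _ | ⟨x, L⟩
    · rw [scaledIndex_nil, scaledIndex_nil, mul_zero]
    rcases M with _ | ⟨y, M⟩
    · rw [oneFour_cons] at hL
      simp only [List.sum_cons, List.sum_nil] at h
      omega
    have hsum := h
    rw [oneFour_cons] at hL hM
    simp only [List.sum_cons] at h ih step
    have self : ∀ z, 0 < z → z + L.sum = x + L.sum → z + L.sum = z + M.sum →
        scaledIndex c (z :: L) (z :: M) = c * scaledIndex 1 (z :: L) (z :: M) := by
      intro z hz h1 h2
      rw [scaledIndex_cons_self, scaledIndex_cons_self,
        ih L.sum (by omega) hL.2 hM.2 (by omega) rfl]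
      ring
    rcases hL.1 with rfl | rfl <;> rcases hM.1 with rfl | rfl
    · exact self 1 one_pos rfl h
    · exact step L M hL.2 hM.2 h h.symm
    · rw [← scaledIndex_swap c hsum, ← scaledIndex_swap 1 hsum]
      exact step M L hM.2 hL.2 h.symm rfl
    · exact self 4 four_pos rfl h

/-! ### Common partial sums -/

/-- Compositions with parts `L` and `M`, the partial sums of which start at `p` and `q`, have no
common partial sum before the end. -/
def NoMeet (p q : ℕ) (L M : List ℕ) : Prop :=
  ∀ L₁ L₂ M₁ M₂, L = L₁ ++ L₂ → M = M₁ ++ M₂ → p + L₁.sum = q + M₁.sum → L₂ = [] ∧ M₂ = []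

theorem noMeet_swap {p q : ℕ} {L M : List ℕ} : NoMeet q p M L ↔ NoMeet p q L M :=
  ⟨fun h _ _ _ _ h1 h2 h3 => (h _ _ _ _ h2 h1 h3.symm).symm,
    fun h _ _ _ _ h1 h2 h3 => (h _ _ _ _ h2 h1 h3.symm).symm⟩

theorem noMeet_cons {p q x : ℕ} {L M : List ℕ} (h : p < q) :
    NoMeet p q (x :: L) M ↔ NoMeet (p + x) q L M := by
  constructor
  · intro hN L₁ L₂ M₁ M₂ hL hM hs
    refine hN (x :: L₁) L₂ M₁ M₂ (by rw [hL, List.cons_append]) hM ?_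
    rw [List.sum_cons]
    omega
  · intro hN L₁ L₂ M₁ M₂ hL hM hs
    rcases L₁ with _ | ⟨y, L₁⟩
    · rw [List.sum_nil] at hs
      omega
    · rw [List.cons_append, List.cons.injEq] at hL
      obtain ⟨rfl, hL⟩ := hL
      rw [List.sum_cons] at hs
      exact hN L₁ L₂ M₁ M₂ hL hM (by omega)

theorem noMeet_add_left {s p q : ℕ} {L M : List ℕ} :
    NoMeet (s + p) (s + q) L M ↔ NoMeet p q L M :=
  forall_congr' fun _ => forall_congr' fun _ => forall_congr' fun _ => forall_congr' fun _ => by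
    rw [add_assoc, add_assoc, add_right_inj]

theorem noMeet_self {p : ℕ} {L M : List ℕ} : NoMeet p p L M ↔ L = [] ∧ M = [] := by
  constructor
  · intro h
    exact h [] L [] M rfl rfl rfl
  · rintro ⟨rfl, rfl⟩ L₁ L₂ M₁ M₂ h1 h2 -
    exact ⟨(List.append_eq_nil_iff.1 h1.symm).2, (List.append_eq_nil_iff.1 h2.symm).2⟩

/-! ### Completions of initial segments and their linear system -/

/-- The pairs of lists with entries `1` and `4` that complete `P` and `Q` to a meander with `n`
nodes and index `k`, where, if `b` holds, the partial sums do not meet before the end. -/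
def completions (b : Prop) (P Q : List ℕ) (n k : ℕ) : Set (List ℕ × List ℕ) :=
  {w | OneFour w.1 ∧ OneFour w.2 ∧ P.sum + w.1.sum = n ∧ Q.sum + w.2.sum = n ∧
    scaledIndex 1 (P ++ w.1) (Q ++ w.2) = k ∧ (b → NoMeet P.sum Q.sum w.1 w.2)}

theorem finite_oneFour (n : ℕ) : {L : List ℕ | OneFour L ∧ L.sum ≤ n}.Finite := by
  refine ((Set.finite_Iic n).biUnion fun s _ =>
    Set.finite_range (Composition.blocks : Composition s → List ℕ)).subset ?_
  rintro L ⟨hL, hs⟩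
  refine Set.mem_biUnion (x := L.sum) hs ⟨⟨L, fun {i} hi => ?_, rfl⟩, rfl⟩
  rcases hL i hi with rfl | rfl <;> norm_num

theorem finite_of_oneFour {S : Set (List ℕ × List ℕ)} (n : ℕ)
    (h : ∀ w ∈ S, OneFour w.1 ∧ OneFour w.2 ∧ w.1.sum ≤ n ∧ w.2.sum ≤ n) : S.Finite :=
  ((finite_oneFour n).prod (finite_oneFour n)).subset fun w hw =>
    ⟨⟨(h w hw).1, (h w hw).2.2.1⟩, ⟨(h w hw).2.1, (h w hw).2.2.2⟩⟩

theorem finite_completions (b : Prop) (P Q : List ℕ) (n k : ℕ) :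
    (completions b P Q n k).Finite := by
  refine finite_of_oneFour n fun w hw => ⟨hw.1, hw.2.1, ?_, ?_⟩
  · have := hw.2.2.1
    omega
  · have := hw.2.2.2.1
    omega

theorem ncard_split_left {S : Set (List ℕ × List ℕ)} (hS : S.Finite)
    (h : ∀ w ∈ S, ∃ L, w.1 = 1 :: L ∨ w.1 = 4 :: L) :
    S.ncard = {w : List ℕ × List ℕ | (1 :: w.1, w.2) ∈ S}.ncard +
      {w : List ℕ × List ℕ | (4 :: w.1, w.2) ∈ S}.ncard := by
  have hinj : ∀ a : ℕ, Function.Injective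
      fun w : List ℕ × List ℕ => (a :: w.1, w.2) := by
    rintro a ⟨L, M⟩ ⟨L', M'⟩ h
    simpa using h
  have hfin : ∀ a : ℕ, ((fun w : List ℕ × List ℕ => (a :: w.1, w.2)) ''
      {w : List ℕ × List ℕ | (a :: w.1, w.2) ∈ S}).Finite := by
    refine fun a => hS.subset ?_
    rintro _ ⟨w, hw, rfl⟩
    exact hw
  rw [← Set.ncard_image_of_injective {w : List ℕ × List ℕ | (1 :: w.1, w.2) ∈ S} (hinj 1),
    ← Set.ncard_image_of_injective {w : List ℕ × List ℕ | (4 :: w.1, w.2) ∈ S} (hinj 4),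
    ← Set.ncard_union_eq ?_ (hfin 1) (hfin 4)]
  · congr 1
    ext ⟨L, M⟩
    constructor
    · intro hw
      obtain ⟨L', hL⟩ := h _ hw
      rcases hL with rfl | rfl
      · exact .inl ⟨(L', M), hw, rfl⟩
      · exact .inr ⟨(L', M), hw, rfl⟩
    · rintro (⟨w, hw, he⟩ | ⟨w, hw, he⟩) <;> exact he ▸ hw
  · rw [Set.disjoint_left]
    rintro _ ⟨w, -, rfl⟩ ⟨w', -, h⟩
    simp at h

theorem ncard_swap (S : Set (List ℕ × List ℕ)) :
    {w : List ℕ × List ℕ | w.swap ∈ S}.ncard = S.ncard := by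
  rw [← Set.ncard_image_of_injective S Prod.swap_injective, Set.image_swap_eq_preimage_swap]
  rfl

theorem ncard_split_right {S : Set (List ℕ × List ℕ)} (hS : S.Finite)
    (h : ∀ w ∈ S, ∃ L, w.2 = 1 :: L ∨ w.2 = 4 :: L) :
    S.ncard = {w : List ℕ × List ℕ | (w.1, 1 :: w.2) ∈ S}.ncard +
      {w : List ℕ × List ℕ | (w.1, 4 :: w.2) ∈ S}.ncard := by
  have hS' : {w : List ℕ × List ℕ | w.swap ∈ S}.Finite := hS.preimage Prod.swap_injective.injOn
  rw [← ncard_swap S, ncard_split_left hS' fun w hw => h _ hw,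
    ← ncard_swap {w : List ℕ × List ℕ | (w.1, 1 :: w.2) ∈ S},
    ← ncard_swap {w : List ℕ × List ℕ | (w.1, 4 :: w.2) ∈ S}]
  rfl

/-- The generating function of the completions of `P` and `Q`. -/
noncomputable def completionSeries (b : Prop) (P Q : List ℕ) : MvPowerSeries (Fin 2) ℚ :=
  fun d => ((completions b P Q (d 0) (d 1)).ncard : ℚ)

theorem coeff_completionSeries (b : Prop) (P Q : List ℕ) (d : Fin 2 →₀ ℕ) :
    MvPowerSeries.coeff d (completionSeries b P Q) = (completions b P Q (d 0) (d 1)).ncard := rfl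

theorem completionSeries_swap (b : Prop) (P Q : List ℕ) :
    completionSeries b Q P = completionSeries b P Q := by
  ext d
  rw [coeff_completionSeries, coeff_completionSeries, ← ncard_swap]
  congr 2
  ext ⟨L, M⟩
  simp only [completions, Set.mem_ofPred_eq, Prod.fst_swap, Prod.snd_swap]
  constructor
  · rintro ⟨h1, h2, h3, h4, h5, h6⟩
    refine ⟨h2, h1, h4, h3, ?_, fun hb => noMeet_swap.1 (h6 hb)⟩
    rw [← h5, scaledIndex_swap]
    simp only [List.sum_append]
    omega
  · rintro ⟨h1, h2, h3, h4, h5, h6⟩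
    refine ⟨h2, h1, h4, h3, ?_, fun hb => noMeet_swap.1 (h6 hb)⟩
    rw [← h5, scaledIndex_swap]
    simp only [List.sum_append]
    omega

theorem completions_cons_left {b : Prop} {P Q : List ℕ} (h : P.sum < Q.sum) (n k : ℕ) {a : ℕ}
    (ha : a = 1 ∨ a = 4) : {w : List ℕ × List ℕ | (a :: w.1, w.2) ∈ completions b P Q n k} =
      completions b (P ++ [a]) Q n k := by
  ext ⟨L, M⟩
  simp only [completions, Set.mem_ofPred_eq, oneFour_cons, ha, true_and, List.sum_cons,
    List.sum_append, List.sum_nil, add_zero, noMeet_cons h, List.append_assoc, List.cons_append,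
    List.nil_append, add_assoc]

/-- The shorter side cannot have ended, since both sides reach the same total. Extending it does not
affect `NoMeet`, because the partial sums differ before the extension. -/
theorem completionSeries_split (b : Prop) {P Q : List ℕ} (h : P.sum < Q.sum) :
    completionSeries b P Q =
      completionSeries b (P ++ [1]) Q + completionSeries b (P ++ [4]) Q := by
  ext d
  rw [map_add, coeff_completionSeries, coeff_completionSeries, coeff_completionSeries,
    ncard_split_left (finite_completions b P Q _ _), completions_cons_left h _ _ (.inl rfl),
    completions_cons_left h _ _ (.inr rfl), Nat.cast_add]
  rintro ⟨L, M⟩ ⟨hL, -, h1, h2, -⟩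
  rcases L with _ | ⟨x, L⟩
  · simp only [List.sum_nil] at h1
    omega
  · rcases (oneFour_cons.1 hL).1 with rfl | rfl
    · exact ⟨L, .inl rfl⟩
    · exact ⟨L, .inr rfl⟩

/-- Turns a reduction of the index into an identity of series. Both sums drop by the same `s`, and
`NoMeet` depends only on their difference. -/
theorem completionSeries_shift (b : Prop) {P Q P' Q' : List ℕ} (s k : ℕ)
    (hP : P.sum = s + P'.sum) (hQ : Q.sum = s + Q'.sum)
    (h : ∀ L M, OneFour L → OneFour M → P'.sum + L.sum = Q'.sum + M.sum →
      scaledIndex 1 (P ++ L) (Q ++ M) = k + scaledIndex 1 (P' ++ L) (Q' ++ M)) :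
    completionSeries b P Q =
      MvPowerSeries.X 0 ^ s * MvPowerSeries.X 1 ^ k * completionSeries b P' Q' := by
  ext d
  rw [MvPowerSeries.X_pow_eq, MvPowerSeries.X_pow_eq, MvPowerSeries.monomial_mul_monomial,
    MvPowerSeries.coeff_monomial_mul, one_mul, one_mul, coeff_completionSeries,
    coeff_completionSeries]
  have hle : Finsupp.single (0 : Fin 2) s + Finsupp.single 1 k ≤ d ↔ s ≤ d 0 ∧ k ≤ d 1 := by
    rw [Finsupp.le_def, Fin.forall_fin_two]
    simp
  split_ifs with hd <;> rw [hle] at hd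
  · congr 2
    ext ⟨L, M⟩
    simp only [completions, Set.mem_ofPred_eq, Finsupp.coe_tsub, Finsupp.coe_add, Pi.sub_apply,
      Pi.add_apply, Finsupp.single_eq_same, hP, hQ, noMeet_add_left]
    refine and_congr_right fun h1 => and_congr_right fun h2 => ?_
    by_cases hs : P'.sum + L.sum = Q'.sum + M.sum
    · rw [h L M h1 h2 hs]
      simp only [Finsupp.single_apply, Fin.reduceEq, if_false, add_zero, zero_add]
      constructor <;> rintro ⟨h3, h4, h5, h6⟩ <;> exact ⟨by omega, by omega, by omega, h6⟩
    · constructor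
      · rintro ⟨h3, h4, -⟩
        omega
      · rintro ⟨h3, h4, -⟩
        omega
  · rw [Nat.cast_eq_zero, Set.ncard_eq_zero (finite_completions _ _ _ _ _),
      Set.eq_empty_iff_forall_notMem]
    rintro ⟨L, M⟩ ⟨h1, h2, h3, h4, h5, -⟩
    simp only at h3 h4 h5
    rw [h L M h1 h2 (by omega)] at h5
    exact hd ⟨by omega, by omega⟩

theorem completionSeries_one_four (b : Prop) {x y : MvPowerSeries (Fin 2) ℚ}
    (hx : x = MvPowerSeries.X 0) (hy : y = MvPowerSeries.X 1) :
    completionSeries b [1] [4] * (1 - x ^ 2 - x ^ 4 - x ^ 3 * y + x ^ 6) =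
      x ^ 4 * y * (x + y - x ^ 3) * completionSeries b [] [] := by
  have hE := completionSeries_split b (P := [1]) (Q := [4]) (by simp)
  have h11 : completionSeries b [1, 1] [4] = x ^ 2 * completionSeries b [] [1, 1] := by
    rw [completionSeries_shift b (P' := []) (Q' := [1, 1]) 2 0 (by simp) (by simp), hx, pow_zero,
      mul_one]
    intro L M _ _ h
    simp only [List.sum_nil, List.sum_cons] at h
    rw [zero_add]
    exact scaledIndex_one_one_four 1 L M (by omega)
  have h14 : completionSeries b [1, 4] [4] = x ^ 4 * completionSeries b [1] [] := by
    rw [completionSeries_shift b (P' := [1]) (Q' := []) 4 0 (by simp) (by simp), hx, pow_zero,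
      mul_one]
    intro L M _ _ h
    simp only [List.sum_nil, List.sum_cons] at h
    rw [zero_add]
    exact scaledIndex_one_four_four 1 L M (by omega)
  have hC := completionSeries_split b (P := []) (Q := [1, 1]) (by simp)
  have hD := completionSeries_split b (P := []) (Q := [1]) (by simp)
  have hself : ∀ P Q, completionSeries b (1 :: P) (1 :: Q) = x * y * completionSeries b P Q := by
    intro P Q
    rw [completionSeries_shift b (P' := P) (Q' := Q) 1 1 (by simp) (by simp), hx, hy, pow_one,
      pow_one]
    intro L M _ _ _
    exact scaledIndex_cons_self 1 1 (P ++ L) (Q ++ M)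
  simp only [List.cons_append, List.nil_append] at hE hC hD
  rw [h11, h14, completionSeries_swap b [] [1]] at hE
  rw [hself, completionSeries_swap b [1, 1] [4], h11] at hC
  rw [hself, completionSeries_swap b [1] [4]] at hD
  -- With E = S(1/4), C = S(∅/11), D = S(∅/1), the system is E = x²C + x⁴D, C = xyD + x²C, D = xy
  -- S(∅/∅) + E; the coefficients eliminate C and D.
  linear_combination (1 - x ^ 2) * hE + x ^ 2 * hC + (x ^ 3 * y + x ^ 4 * (1 - x ^ 2)) * hD

/-- The pairs of nonempty lists with entries `1` and `4` that form a meander with `n` nodes and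
index `k`, where, if `b` holds, the partial sums do not meet before the end. -/
def nonemptyPairs (b : Prop) (n k : ℕ) : Set (List ℕ × List ℕ) :=
  {w | OneFour w.1 ∧ OneFour w.2 ∧ w.1.sum = n ∧ w.2.sum = n ∧ scaledIndex 1 w.1 w.2 = k ∧
    ∃ p q L M, w.1 = p :: L ∧ w.2 = q :: M ∧ (b → NoMeet p q L M)}

theorem ncard_nonemptyPairs (b : Prop) (n k : ℕ) :
    (nonemptyPairs b n k).ncard =
      (completions b [1] [1] n k).ncard + (completions b [1] [4] n k).ncard +
        ((completions b [4] [1] n k).ncard + (completions b [4] [4] n k).ncard) := by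
  have hfin : (nonemptyPairs b n k).Finite :=
    finite_of_oneFour n fun w hw => ⟨hw.1, hw.2.1, hw.2.2.1.le, hw.2.2.2.1.le⟩
  have hinj : ∀ a : ℕ, Function.Injective fun w : List ℕ × List ℕ => (a :: w.1, w.2) := by
    rintro a ⟨L, M⟩ ⟨L', M'⟩ h
    simpa using h
  have hfin' : ∀ a : ℕ, {w : List ℕ × List ℕ | (a :: w.1, w.2) ∈ nonemptyPairs b n k}.Finite :=
    fun a => hfin.preimage (hinj a).injOn
  have hright : ∀ a : ℕ, ∀ w ∈ {w : List ℕ × List ℕ | (a :: w.1, w.2) ∈ nonemptyPairs b n k},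
      ∃ M, w.2 = 1 :: M ∨ w.2 = 4 :: M := by
    rintro a ⟨L, M⟩ ⟨-, h2, -, -, -, p, q, L', M', -, hM, -⟩
    simp only at h2 hM
    subst hM
    rcases (oneFour_cons.1 h2).1 with rfl | rfl
    · exact ⟨M', .inl rfl⟩
    · exact ⟨M', .inr rfl⟩
  have hset : ∀ a c : ℕ, (a = 1 ∨ a = 4) → (c = 1 ∨ c = 4) →
      {w : List ℕ × List ℕ | (w.1, c :: w.2) ∈
        {w : List ℕ × List ℕ | (a :: w.1, w.2) ∈ nonemptyPairs b n k}} =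
        completions b [a] [c] n k := by
    intro a c ha hc
    ext ⟨L, M⟩
    simp only [nonemptyPairs, completions, Set.mem_ofPred_eq, oneFour_cons, ha, hc, true_and,
      List.sum_cons, List.sum_nil, add_zero, List.cons_append, List.nil_append, List.cons.injEq]
    refine and_congr_right fun _ => and_congr_right fun _ => and_congr_right fun _ =>
      and_congr_right fun _ => and_congr_right fun _ => ⟨?_, fun h => ?_⟩
    · rintro ⟨p, q, L', M', ⟨rfl, rfl⟩, ⟨rfl, rfl⟩, h⟩
      exact h
    · exact ⟨a, c, L, M, ⟨rfl, rfl⟩, ⟨rfl, rfl⟩, h⟩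
  rw [ncard_split_left hfin, ncard_split_right (hfin' 1) (hright 1),
    ncard_split_right (hfin' 4) (hright 4), hset 1 1 (.inl rfl) (.inl rfl),
    hset 1 4 (.inl rfl) (.inr rfl), hset 4 1 (.inr rfl) (.inl rfl), hset 4 4 (.inr rfl) (.inr rfl)]
  rintro ⟨L, M⟩ ⟨h1, -, -, -, -, p, q, L', M', hL, -, -⟩
  simp only at h1 hL
  subst hL
  rcases (oneFour_cons.1 h1).1 with rfl | rfl
  · exact ⟨L', .inl rfl⟩
  · exact ⟨L', .inr rfl⟩

/-- The generating function of `nonemptyPairs`. -/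
noncomputable def nonemptyPairsSeries (b : Prop) : MvPowerSeries (Fin 2) ℚ :=
  fun d => ((nonemptyPairs b (d 0) (d 1)).ncard : ℚ)

theorem coeff_nonemptyPairsSeries (b : Prop) (d : Fin 2 →₀ ℕ) :
    MvPowerSeries.coeff d (nonemptyPairsSeries b) = (nonemptyPairs b (d 0) (d 1)).ncard := rfl

/-- Classification by the two first parts; 1 over 4 and 4 over 1 contribute equally by symmetry. -/
theorem nonemptyPairsSeries_eq (b : Prop) {x y : MvPowerSeries (Fin 2) ℚ}
    (hx : x = MvPowerSeries.X 0) (hy : y = MvPowerSeries.X 1) :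
    nonemptyPairsSeries b = (x * y + x ^ 4 * y ^ 4) * completionSeries b [] [] +
      2 * completionSeries b [1] [4] := by
  have hself : ∀ a, completionSeries b [a] [a] = x ^ a * y ^ a * completionSeries b [] [] := by
    intro a
    rw [completionSeries_shift b (P' := []) (Q' := []) a a (by simp) (by simp), hx, hy]
    intro L M _ _ _
    have := scaledIndex_cons_self 1 a L M
    rwa [one_mul] at this
  have hsum : nonemptyPairsSeries b = completionSeries b [1] [1] + completionSeries b [1] [4] +
      (completionSeries b [4] [1] + completionSeries b [4] [4]) := by
    ext d
    simp only [map_add, coeff_nonemptyPairsSeries, coeff_completionSeries, ncard_nonemptyPairs,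
      Nat.cast_add]
  rw [hsum, hself 1, hself 4, completionSeries_swap b [1] [4]]
  ring

theorem oneFour_pos {L : List ℕ} (hL : OneFour L) (h : L ≠ []) : 0 < L.sum := by
  rcases L with _ | ⟨a, L⟩
  · exact absurd rfl h
  · rw [List.sum_cons]
    rcases (oneFour_cons.1 hL).1 with rfl | rfl <;> omega

theorem completions_nil_zero (b : Prop) :
    completions b [] [] 0 0 = {([], [])} := by
  ext ⟨L, M⟩
  simp only [completions, Set.mem_ofPred_eq, Set.mem_singleton_iff, Prod.mk.injEq]
  constructor
  · rintro ⟨h1, h2, h3, h4, -⟩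
    constructor <;> by_contra hne
    · have := oneFour_pos h1 hne
      simp at h3
      omega
    · have := oneFour_pos h2 hne
      simp at h4
      omega
  · rintro ⟨rfl, rfl⟩
    exact ⟨oneFour_nil, oneFour_nil, rfl, rfl, scaledIndex_nil _ _,
      fun _ => noMeet_self.2 ⟨rfl, rfl⟩⟩

theorem coeff_one_fin_two (d : Fin 2 →₀ ℕ) :
    MvPowerSeries.coeff d (1 : MvPowerSeries (Fin 2) ℚ) =
      if d 0 = 0 ∧ d 1 = 0 then 1 else 0 := by
  classical
  rw [MvPowerSeries.coeff_one]
  refine if_congr ?_ rfl rfl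
  rw [Finsupp.ext_iff, Fin.forall_fin_two]
  rfl

/-- The partial sums already agree at the start, so only the empty completion is allowed. -/
theorem completionSeries_true : completionSeries True [] [] = 1 := by
  ext d
  rw [coeff_completionSeries, coeff_one_fin_two]
  split_ifs with h
  · rw [h.1, h.2, completions_nil_zero, Set.ncard_singleton, Nat.cast_one]
  · rw [Nat.cast_eq_zero, Set.ncard_eq_zero (finite_completions _ _ _ _ _),
      Set.eq_empty_iff_forall_notMem]
    rintro ⟨L, M⟩ ⟨-, -, h3, -, h5, h6⟩
    obtain ⟨rfl, rfl⟩ := noMeet_self.1 (h6 trivial)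
    exact h ⟨h3.symm, h5.symm.trans (scaledIndex_nil _ _)⟩

theorem completionSeries_false :
    completionSeries False [] [] = 1 + nonemptyPairsSeries False := by
  ext d
  rw [map_add, coeff_completionSeries, coeff_one_fin_two, coeff_nonemptyPairsSeries]
  by_cases h0 : d 0 = 0
  · have hemp : nonemptyPairs False (d 0) (d 1) = ∅ := by
      rw [Set.eq_empty_iff_forall_notMem]
      rintro ⟨L, M⟩ ⟨h1, -, h3, -, -, p, q, L', M', rfl, -⟩
      have : 0 < (p :: L').sum := oneFour_pos h1 (List.cons_ne_nil _ _)
      change (p :: L').sum = d 0 at h3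
      omega
    rw [hemp, Set.ncard_empty, Nat.cast_zero, add_zero, h0]
    by_cases h1 : d 1 = 0
    · rw [h1, completions_nil_zero, Set.ncard_singleton, if_pos ⟨rfl, rfl⟩, Nat.cast_one]
    · rw [if_neg fun h => h1 h.2, Nat.cast_eq_zero,
        Set.ncard_eq_zero (finite_completions _ _ _ _ _), Set.eq_empty_iff_forall_notMem]
      rintro ⟨L, M⟩ ⟨h2, -, h3, -, h5, -⟩
      rcases L with _ | ⟨a, L⟩
      · exact h1 (h5.symm.trans (scaledIndex_nil _ _))
      · have : 0 < (a :: L).sum := oneFour_pos h2 (List.cons_ne_nil _ _)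
        change 0 + (a :: L).sum = 0 at h3
        omega
  · rw [if_neg fun h => h0 h.1, zero_add]
    congr 2
    ext ⟨L, M⟩
    simp only [completions, nonemptyPairs, Set.mem_ofPred_eq, List.sum_nil, zero_add,
      List.nil_append, false_imp_iff, and_true]
    refine and_congr_right fun _ => and_congr_right fun _ => and_congr_right fun h3 =>
      and_congr_right fun h4 => ⟨fun h => ⟨h, ?_⟩, fun h => h.1⟩
    rcases L with _ | ⟨p, L⟩
    · exact absurd h3.symm h0
    rcases M with _ | ⟨q, M⟩
    · exact absurd h4.symm h0
    exact ⟨p, q, L, M, rfl, rfl⟩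

/-! ### From pairs of lists back to meanders -/

theorem ncard_meander {n c : ℕ} (hc : c ≠ 0) (p : List ℕ → List ℕ → Prop) :
    {m : Meander n | m.PartsIn {c, 4 * c} ∧ p m.1.blocks m.2.blocks}.ncard =
      {w : List ℕ × List ℕ | OneFour w.1 ∧ OneFour w.2 ∧ c * w.1.sum = n ∧ c * w.2.sum = n ∧
        p (w.1.map (c * ·)) (w.2.map (c * ·))}.ncard := by
  have hf : Function.Injective fun m : Meander n => (m.1.blocks, m.2.blocks) := by
    rintro ⟨m₁, m₂⟩ ⟨m₁', m₂'⟩ h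
    rw [Prod.mk.injEq] at h
    exact Prod.ext (Composition.ext h.1) (Composition.ext h.2)
  have hmul : Function.Injective fun a : ℕ => c * a :=
    fun a a' h => Nat.eq_of_mul_eq_mul_left (Nat.pos_of_ne_zero hc) h
  have hsum : ∀ L : List ℕ, (L.map (c * ·)).sum = c * L.sum := by
    intro L
    rw [List.sum_map_mul_left, List.map_id']
  have hg : Function.Injective
      fun w : List ℕ × List ℕ => (w.1.map (c * ·), w.2.map (c * ·)) := by
    rintro ⟨L, M⟩ ⟨L', M'⟩ h
    rw [Prod.mk.injEq] at h
    exact Prod.ext (List.map_injective_iff.2 hmul h.1) (List.map_injective_iff.2 hmul h.2)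
  have hlist : ∀ L : List ℕ, (∀ a ∈ L, a ∈ ({c, 4 * c} : Set ℕ)) →
      ∃ L', OneFour L' ∧ L = L'.map (c * ·) := by
    intro L hL
    induction L with
    | nil => exact ⟨[], oneFour_nil, rfl⟩
    | cons a L ih =>
      obtain ⟨L', h1, rfl⟩ := ih fun a ha => hL a (List.mem_cons_of_mem _ ha)
      rcases hL a List.mem_cons_self with rfl | rfl
      · exact ⟨1 :: L', oneFour_cons.2 ⟨.inl rfl, h1⟩, by simp⟩
      · exact ⟨4 :: L', oneFour_cons.2 ⟨.inr rfl, h1⟩, by simp [mul_comm]⟩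
  have hlist' : ∀ L, OneFour L → ∀ a ∈ L.map (c * ·), a ∈ ({c, 4 * c} : Set ℕ) := by
    intro L hL a ha
    obtain ⟨b, hb, rfl⟩ := List.mem_map.1 ha
    rcases hL b hb with rfl | rfl
    · exact .inl (mul_one c)
    · exact .inr (mul_comm c 4)
  have hpos : ∀ L, OneFour L → ∀ {a}, a ∈ L.map (c * ·) → 0 < a := by
    intro L hL a ha
    rcases hlist' L hL a ha with rfl | rfl <;> omega
  refine (Set.ncard_image_of_injective _ hf).symm.trans
    (Eq.trans ?_ (Set.ncard_image_of_injective _ hg))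
  congr 1
  ext ⟨A, B⟩
  constructor
  · rintro ⟨m, ⟨⟨h1, h2⟩, h3⟩, h⟩
    obtain ⟨L, hL, hL'⟩ := hlist _ h1
    obtain ⟨M, hM, hM'⟩ := hlist _ h2
    refine ⟨(L, M), ⟨hL, hM, ?_, ?_, ?_⟩, ?_⟩
    · rw [← hsum, ← hL', m.1.blocks_sum]
    · rw [← hsum, ← hM', m.2.blocks_sum]
    · rwa [← hL', ← hM']
    · rw [← h]
      exact Prod.ext hL'.symm hM'.symm
  · rintro ⟨⟨L, M⟩, ⟨hL, hM, h1, h2, h3⟩, h⟩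
    refine ⟨(⟨L.map (c * ·), hpos L hL, ?_⟩, ⟨M.map (c * ·), hpos M hM, ?_⟩),
      ⟨⟨hlist' L hL, hlist' M hM⟩, h3⟩, h⟩
    · rw [← h1, hsum]
    · rw [← h2, hsum]

theorem Meander.count_eq {c : ℕ} (hc : c ≠ 0) (n k : ℕ) :
    Meander.count {c, 4 * c} n k =
      {w : List ℕ × List ℕ | OneFour w.1 ∧ OneFour w.2 ∧ c * w.1.sum = n ∧ c * w.2.sum = n ∧
        c * scaledIndex 1 w.1 w.2 = k}.ncard := by
  have h := ncard_meander (n := n) hc fun A B => listIndex n A B = k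
  simp only [← Meander.ind_eq_listIndex] at h
  rw [Meander.count, h]
  congr 1
  ext ⟨L, M⟩
  refine and_congr_right fun h1 => and_congr_right fun h2 => and_congr_right fun h3 =>
    and_congr_right fun h4 => ?_
  have hsum : L.sum = M.sum := Nat.eq_of_mul_eq_mul_left (Nat.pos_of_ne_zero hc) (h3.trans h4.symm)
  rw [← scaledIndex_eq_mul c h1 h2 hsum, scaledIndex, h3]

theorem Meander.genFun_one_four : Meander.genFun {1, 4} = completionSeries False [] [] := by
  ext d
  have h := Meander.count_eq one_ne_zero (d 0) (d 1)
  rw [mul_one] at h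
  rw [coeff_completionSeries]
  change (Meander.count {1, 4} (d 0) (d 1) : ℚ) = _
  rw [h]
  congr 2
  ext ⟨L, M⟩
  simp only [completions, Set.mem_ofPred_eq, one_mul, List.sum_nil, zero_add, List.nil_append,
    false_imp_iff, and_true]

theorem Meander.genFun_expand {c : ℕ} (hc : c ≠ 0) :
    Meander.genFun {c, 4 * c} = MvPowerSeries.expand c hc (Meander.genFun {1, 4}) := by
  have hpos := Nat.pos_of_ne_zero hc
  ext d
  change (Meander.count {c, 4 * c} (d 0) (d 1) : ℚ) = _
  rw [Meander.count_eq hc]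
  by_cases hd : ∀ i, c ∣ d i
  · obtain ⟨d', rfl⟩ : ∃ d' : Fin 2 →₀ ℕ, d = c • d' := by
      choose f hf using hd
      exact ⟨Finsupp.equivFunOnFinite.symm f, Finsupp.ext fun i => by simpa using hf i⟩
    rw [MvPowerSeries.coeff_expand_smul, Meander.genFun_one_four, coeff_completionSeries]
    congr 2
    ext ⟨L, M⟩
    simp only [completions, Set.mem_ofPred_eq, Finsupp.smul_apply, smul_eq_mul, List.sum_nil,
      zero_add, List.nil_append, false_imp_iff, and_true, Nat.mul_right_inj hc]
  -- Node number and index are both multiples of c, so no other exponents occur.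
  · push Not at hd
    obtain ⟨i, hi⟩ := hd
    rw [MvPowerSeries.coeff_expand_of_not_dvd c hc _ hi, Nat.cast_eq_zero]
    refine (congrArg Set.ncard (Set.eq_empty_iff_forall_notMem.2 ?_)).trans (Set.ncard_empty _)
    rintro ⟨L, M⟩ ⟨-, -, h1, -, h2⟩
    fin_cases i
    · exact hi ⟨_, h1.symm⟩
    · exact hi ⟨_, h2.symm⟩

/-- A direct sum decomposition is a common partial sum strictly between 0 and `n`. -/
theorem Meander.isIndecomposable_iff {n : ℕ} (m : Meander n) :
    m.IsIndecomposable ↔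
      ∃ p q L M, m.1.blocks = p :: L ∧ m.2.blocks = q :: M ∧ NoMeet p q L M := by
  constructor
  · rintro ⟨hn, h⟩
    have hsum1 := m.1.blocks_sum
    have hsum2 := m.2.blocks_sum
    have hpos1 : ∀ i ∈ m.1.blocks, 0 < i := fun i hi => m.1.blocks_pos hi
    have hpos2 : ∀ i ∈ m.2.blocks, 0 < i := fun i hi => m.2.blocks_pos hi
    rcases h1 : m.1.blocks with _ | ⟨p, L⟩
    · rw [h1, List.sum_nil] at hsum1
      omega
    rcases h2 : m.2.blocks with _ | ⟨q, M⟩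
    · rw [h2, List.sum_nil] at hsum2
      omega
    refine ⟨p, q, L, M, rfl, rfl, ?_⟩
    rintro L₁ L₂ M₁ M₂ rfl rfl hs
    rw [h1, List.sum_cons, List.sum_append] at hsum1
    rw [h2, List.sum_cons, List.sum_append] at hsum2
    rw [h1] at hpos1
    rw [h2] at hpos2
    have hp := hpos1 p List.mem_cons_self
    by_contra hne
    have hL₂ : 0 < L₂.sum := by
      rw [Nat.pos_iff_ne_zero]
      intro h0
      refine hne ⟨?_, ?_⟩
      · rw [List.eq_nil_iff_forall_not_mem]
        intro i hi
        have := List.single_le_sum (fun _ _ => Nat.zero_le _) i hi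
        have := hpos1 i (by simp [hi])
        omega
      · rw [List.eq_nil_iff_forall_not_mem]
        intro i hi
        have := List.single_le_sum (fun _ _ => Nat.zero_le _) i hi
        have := hpos2 i (by simp [hi])
        omega
    refine h ⟨p + L₁.sum, L₂.sum, by omega, by omega,
      (⟨p :: L₁, fun {i} hi => hpos1 i ?_, rfl⟩, ⟨q :: M₁, fun {i} hi => hpos2 i ?_, hs.symm⟩),
      (⟨L₂, fun {i} hi => hpos1 i ?_, rfl⟩, ⟨M₂, fun {i} hi => hpos2 i ?_, by omega⟩), h1, h2⟩
    · rw [List.mem_cons, List.mem_append]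
      rcases List.mem_cons.1 hi with h | h
      · exact .inl h
      · exact .inr (.inl h)
    · rw [List.mem_cons, List.mem_append]
      rcases List.mem_cons.1 hi with h | h
      · exact .inl h
      · exact .inr (.inl h)
    · simp [hi]
    · simp [hi]
  · rintro ⟨p, q, L, M, hL, hM, h⟩
    have hsum := m.1.blocks_sum
    have hp : 0 < p := m.1.blocks_pos (by rw [hL]; exact List.mem_cons_self)
    have hn : 0 < n := by
      rw [hL, List.sum_cons] at hsum
      omega
    refine ⟨hn, ?_⟩
    rintro ⟨a, b, ha, hb, m₁, m₂, h1, h2⟩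
    have hab : a + b = n := by
      rw [← hsum, h1, List.sum_append, m₁.1.blocks_sum, m₂.1.blocks_sum]
    have ha1 := m₁.1.blocks_sum
    have ha2 := m₁.2.blocks_sum
    have hb1 := m₂.1.blocks_sum
    rw [hL] at h1
    rw [hM] at h2
    rcases hA : m₁.1.blocks with _ | ⟨p', L₁⟩
    · rw [hA, List.sum_nil] at ha1
      omega
    rcases hB : m₁.2.blocks with _ | ⟨q', M₁⟩
    · rw [hB, List.sum_nil] at ha2
      omega
    rw [hA, List.sum_cons] at ha1
    rw [hB, List.sum_cons] at ha2
    rw [hA, List.cons_append, List.cons.injEq] at h1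
    rw [hB, List.cons_append, List.cons.injEq] at h2
    obtain ⟨rfl, h1⟩ := h1
    obtain ⟨rfl, h2⟩ := h2
    have := (h _ _ _ _ h1 h2 (ha1.trans ha2.symm)).1
    rw [this, List.sum_nil] at hb1
    omega

theorem Meander.indecomposableCount_natCast (n k : ℕ) :
    Meander.indecomposableCount {1, 4} n k = (nonemptyPairs True n k).ncard := by
  have h := ncard_meander (n := n) one_ne_zero fun A B =>
    (∃ p q L M, A = p :: L ∧ B = q :: M ∧ NoMeet p q L M) ∧ listIndex n A B = k
  simp only [← Meander.ind_eq_listIndex, ← Meander.isIndecomposable_iff, mul_one] at h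
  rw [Meander.indecomposableCount]
  have h' : {m : Meander n | m.IsIndecomposable ∧ m.PartsIn {1, 4} ∧ (m.ind : ℤ) = k} =
      {m : Meander n | m.PartsIn {1, 4} ∧ m.IsIndecomposable ∧ m.ind = k} := by
    ext m
    simp only [Set.mem_ofPred_eq, Nat.cast_inj]
    tauto
  rw [h', h]
  congr 1
  ext ⟨L, M⟩
  simp only [nonemptyPairs, Set.mem_ofPred_eq, one_mul, List.map_id', true_imp_iff]
  refine and_congr_right fun _ => and_congr_right fun _ => and_congr_right fun h3 =>
    and_congr_right fun _ => ?_
  rw [and_comm, scaledIndex, h3]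
  simp only [one_mul, List.map_id']

theorem Meander.indecomposableCount_of_neg (J : Set ℕ) (n : ℕ) {k : ℤ} (hk : k < 0) :
    Meander.indecomposableCount J n k = 0 := by
  refine (congrArg Set.ncard (Set.eq_empty_iff_forall_notMem.2 ?_)).trans (Set.ncard_empty _)
  rintro m ⟨-, -, h⟩
  omega

/-! ### Extraction of coefficients, and the theorem -/

/-- The coefficient of `x ^ n * y ^ k`. -/
noncomputable def coeffTwo (n k : ℕ) : MvPowerSeries (Fin 2) ℚ →ₗ[ℚ] ℚ :=
  MvPowerSeries.coeff (Finsupp.single 0 n + Finsupp.single 1 k)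

theorem coeffTwo_mul (n k s t : ℕ) (φ : MvPowerSeries (Fin 2) ℚ) :
    coeffTwo n k (MvPowerSeries.X 0 ^ s * MvPowerSeries.X 1 ^ t * φ) =
      if s ≤ n ∧ t ≤ k then coeffTwo (n - s) (k - t) φ else 0 := by
  rw [coeffTwo, MvPowerSeries.X_pow_eq, MvPowerSeries.X_pow_eq,
    MvPowerSeries.monomial_mul_monomial, MvPowerSeries.coeff_monomial_mul, one_mul, one_mul]
  have hle : Finsupp.single (0 : Fin 2) s + Finsupp.single 1 t ≤
      Finsupp.single 0 n + Finsupp.single 1 k ↔ s ≤ n ∧ t ≤ k := by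
    rw [Finsupp.le_def, Fin.forall_fin_two]
    simp
  refine if_congr hle ?_ rfl
  have hsub : Finsupp.single (0 : Fin 2) n + Finsupp.single 1 k -
      (Finsupp.single 0 s + Finsupp.single 1 t) =
        Finsupp.single 0 (n - s) + Finsupp.single 1 (k - t) := by
    ext i
    fin_cases i <;> simp
  rw [hsub, coeffTwo]

theorem coeffTwo_monomial_of_lt {n k s t : ℕ} (h : s < n) :
    coeffTwo n k (MvPowerSeries.X 0 ^ s * MvPowerSeries.X 1 ^ t) = 0 := by
  rw [← mul_one (MvPowerSeries.X 0 ^ s * MvPowerSeries.X 1 ^ t), coeffTwo_mul]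
  split_ifs
  · rw [coeffTwo, coeff_one_fin_two, if_neg]
    simp
    omega
  · rfl

theorem coeffTwo_nonemptyPairsSeries (n k : ℕ) :
    coeffTwo n k (nonemptyPairsSeries True) = Meander.indecomposableCount {1, 4} n k := by
  rw [coeffTwo, coeff_nonemptyPairsSeries, Meander.indecomposableCount_natCast]
  simp

theorem Meander.indecomposableCount_recurrence (n k : ℕ) (hn : 10 < n) :
    (Meander.indecomposableCount {1, 4} n k : ℤ) =
      Meander.indecomposableCount {1, 4} (n - 2) k
        + Meander.indecomposableCount {1, 4} (n - 3) (k - 1)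
        + Meander.indecomposableCount {1, 4} (n - 4) k
        - Meander.indecomposableCount {1, 4} (n - 6) k := by
  set x : MvPowerSeries (Fin 2) ℚ := MvPowerSeries.X 0 with hx
  set y : MvPowerSeries (Fin 2) ℚ := MvPowerSeries.X 1 with hy
  have hE := completionSeries_one_four True hx hy
  have hI := nonemptyPairsSeries_eq True hx hy
  rw [completionSeries_true, mul_one] at hE hI
  set I := nonemptyPairsSeries True
  -- The last summand is the numerator of I. Its top power `x ^ 10` comes from x⁴y⁴ · x⁶ and is the
  -- source of the bound on `n`.
  have key : I = x ^ 2 * y ^ 0 * I + x ^ 3 * y ^ 1 * I + x ^ 4 * y ^ 0 * I - x ^ 6 * y ^ 0 * I +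
      ((x ^ 1 * y ^ 1 + x ^ 4 * y ^ 4) - (x ^ 3 * y ^ 1 + x ^ 6 * y ^ 4)
        - (x ^ 5 * y ^ 1 + x ^ 8 * y ^ 4) - (x ^ 4 * y ^ 2 + x ^ 7 * y ^ 5)
        + (x ^ 7 * y ^ 1 + x ^ 10 * y ^ 4)
        + (2 : ℚ) • (x ^ 5 * y ^ 1 + x ^ 4 * y ^ 2 - x ^ 7 * y ^ 1)) := by
    rw [ofNat_smul_eq_nsmul, nsmul_eq_mul]
    push_cast
    linear_combination (1 - x ^ 2 - x ^ 4 - x ^ 3 * y + x ^ 6) * hI + 2 * hE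
  have h := congrArg (coeffTwo n k) key
  simp only [map_add, map_sub, map_smul] at h
  rw [coeffTwo_mul, coeffTwo_mul, coeffTwo_mul, coeffTwo_mul] at h
  simp only [hx, hy] at h
  simp only [coeffTwo_monomial_of_lt (show 1 < n by omega),
    coeffTwo_monomial_of_lt (show 3 < n by omega), coeffTwo_monomial_of_lt (show 4 < n by omega),
    coeffTwo_monomial_of_lt (show 5 < n by omega), coeffTwo_monomial_of_lt (show 6 < n by omega),
    coeffTwo_monomial_of_lt (show 7 < n by omega), coeffTwo_monomial_of_lt (show 8 < n by omega),
    coeffTwo_monomial_of_lt hn, add_zero, sub_zero, smul_zero, zero_le, and_true, Nat.sub_zero,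
    if_pos (show 2 ≤ n by omega), if_pos (show 4 ≤ n by omega), if_pos (show 6 ≤ n by omega),
    show 3 ≤ n by omega, true_and, I, coeffTwo_nonemptyPairsSeries] at h
  -- For `k = 0` the integer `k - 1` is negative and the count is 0, matching the vanishing
  -- coefficient.
  have h1 : ((Meander.indecomposableCount {1, 4} (n - 3) (k - 1) : ℕ) : ℚ) =
      if 1 ≤ k then ((Meander.indecomposableCount {1, 4} (n - 3) (k - 1 : ℕ) : ℕ) : ℚ) else 0 := by
    split_ifs with hk
    · rw [Nat.cast_sub hk, Nat.cast_one]
    · rw [Meander.indecomposableCount_of_neg _ _ (by omega), Nat.cast_zero]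
  rw [← h1] at h
  exact_mod_cast h

theorem Meander.genFun_one_four_eq {x y : MvPowerSeries (Fin 2) ℚ}
    (hx : x = MvPowerSeries.X 0) (hy : y = MvPowerSeries.X 1) :
    Meander.genFun {1, 4} =
      (1 - x ^ 2 - x ^ 4 - x ^ 3 * y + x ^ 6) *
        ((1 - x * y - x ^ 4 * y ^ 4) * (1 - x ^ 2 - x ^ 4 - x ^ 3 * y + x ^ 6)
          - 2 * x ^ 4 * y * (x + y - x ^ 3))⁻¹ := by
  -- The denominator has constant coefficient 1, so its inverse is a genuine one.
  rw [MvPowerSeries.eq_mul_inv_iff_mul_eq (by simp [hx, hy]), Meander.genFun_one_four]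
  have hE := completionSeries_one_four False hx hy
  have hI := nonemptyPairsSeries_eq False hx hy
  have hA := completionSeries_false
  linear_combination (1 - x ^ 2 - x ^ 4 - x ^ 3 * y + x ^ 6) * (hA + hI) + 2 * hE

theorem mainTheorem5 :
    (∀ x y : MvPowerSeries (Fin 2) ℚ, x = MvPowerSeries.X 0 → y = MvPowerSeries.X 1 →
      Meander.genFun {1, 4} =
        (1 - x ^ 2 - x ^ 4 - x ^ 3 * y + x ^ 6) *
          ((1 - x * y - x ^ 4 * y ^ 4) * (1 - x ^ 2 - x ^ 4 - x ^ 3 * y + x ^ 6)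
            - 2 * x ^ 4 * y * (x + y - x ^ 3))⁻¹) ∧
    (∀ (n : ℕ) (k : ℤ), 10 < n →
      (Meander.indecomposableCount {1, 4} n k : ℤ) =
        Meander.indecomposableCount {1, 4} (n - 2) k
          + Meander.indecomposableCount {1, 4} (n - 3) (k - 1)
          + Meander.indecomposableCount {1, 4} (n - 4) k
          - Meander.indecomposableCount {1, 4} (n - 6) k) ∧
    (∀ (c : ℕ) (hc : c ≠ 0),
      Meander.genFun {c, 4 * c} = MvPowerSeries.expand c hc (Meander.genFun {1, 4})) := by
  refine ⟨fun x y hx hy => Meander.genFun_one_four_eq hx hy, fun n k hn => ?_,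
    fun c hc => Meander.genFun_expand hc⟩
  rcases lt_or_ge k 0 with hk | hk
  · rw [Meander.indecomposableCount_of_neg _ _ hk, Meander.indecomposableCount_of_neg _ _ hk,
      Meander.indecomposableCount_of_neg _ _ hk, Meander.indecomposableCount_of_neg _ _ hk,
      Meander.indecomposableCount_of_neg _ _ (by omega)]
    simp
  · lift k to ℕ using hk
    exact Meander.indecomposableCount_recurrence n k hn
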